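/- Let $\mathcal H$ be a finite dimensional complex Hilbert space, $\langle A|B\rangle=\mathrm{tr}(A^*B)$ for operators $A,B$ on $\mathcal H$, and let $$\mathcal L(X)=-\mathrm i[H,X]+\sum_l\Big(\Gamma_lX\Gamma_l^*-\tfrac12\{\Gamma_l^*\Gamma_l,X\}\Big)$$ be a Lindbladian with a fixed representation by a self-adjoint operator $H$ and finitely many operators $\Gamma_l$ on $\mathcal H$. Put $\Phi(X)=\sum_l\Gamma_l^*X\Gamma_l$ and let $\mathcal L^\dagger$ be the adjoint of $\mathcal L$ for the bracket, so that $\mathcal L^\dagger(X)=\mathrm i[H,X]-\frac12\{\Phi(\mathbb I),X\}+\Phi(X)$. A state is an operator $\rho\ge0$ with $\mathrm{tr}\,\rho=1$. Assume that $(\rho^+,\mathcal L)$ satisfies detailed balance: $\rho^+$ is a state with trivial kernel, $\mathcal L(\rho^+)=0$, and $\mathrm{tr}(\rho^+A^*\Phi(B))=\mathrm{tr}(\rho^+\Phi(A)^*B)$ for all operators $A,B$. Set $S^+=-\log\rho^+=\sum_{s\in\mathrm{spec}(S^+)}sP_s$ (spectral decomposition). For a state $\rho$ let $S(\rho)=-\langle\rho|\log\rho\rangle$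 be its von Neumann entropy (with $0\log0=0$), let $\mathrm{Ent}(\mu|\nu)=\langle\mu|\log\mu-\log\nu\rangle$ if $\ker\nu\subset\ker\mu$ and $+\infty$ otherwise, and let $$\mathrm{EP}(\rho)=-\frac{\mathrm d}{\mathrm dh}\mathrm{Ent}(\mathrm e^{h\mathcal L}(\rho)|\rho^+)\Big|_{h=0}$$ (right derivative, taken in $[-\infty,\infty]$) be the entropy production. Let $\rho_0$ be a state and $t\ge0$. Let $\mathbb Q^t_{\rho_0}$ be the law of $\Delta S^+=s'-s$ when the pair of outcomes $(s,s')\in\mathrm{spec}(S^+)^2$ of the two-time measurement of $S^+$ has probability $\langle\mathrm e^{t\mathcal L}(P_s\rho_0P_s)|P_{s'}\rangle$, and let $\mathbb E^t_{\rho_0}$ be the corresponding expectation. Then $\mathbb Q^t_{\rho_0}$ is a probability law, and: (i) The first measurement causes no decoherence: for every $s'\in\mathrm{spec}(S^+)$, $$\sum_{s\in\mathrm{spec}(S^+)}\langle\mathrm e^{t\mathcal L}(P_s\rho_0P_s)|P_{s'}\rangle=\langle\mathrm e^{t\mathcal L}(\rho_0)|P_{s'}\rangle.$$ (ii) $\mathbb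 E^t_{\rho_0}(\Delta S^+)=\langle\mathrm e^{t\mathcal L}(\rho_0)|S^+\rangle-\langle\rho_0|S^+\rangle$. (iii) For every $s\ge0$ the derivative defining $\mathrm{EP}(\mathrm e^{s\mathcal L}(\rho_0))$ exists in $[-\infty,\infty]$, for $s>0$ it is finite, $s\mapsto\mathrm{EP}(\mathrm e^{s\mathcal L}(\rho_0))$ is integrable on $[0,t]$, and $$\mathbb E^t_{\rho_0}(\Delta S^+)=\int_0^t\langle\mathrm e^{s\mathcal L}(\rho_0)|\mathcal L^\dagger(S^+)\rangle\,\mathrm ds=S(\mathrm e^{t\mathcal L}(\rho_0))-S(\rho_0)-\int_0^t\mathrm{EP}(\mathrm e^{s\mathcal L}(\rho_0))\,\mathrm ds.$$ -/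

import Mathlib

open MeasureTheory Filter Topology

namespace OpenQS

noncomputable section

variable {ℋ : Type*} [NormedAddCommGroup ℋ] [InnerProductSpace ℂ ℋ] [CompleteSpace ℋ]

/-- The trace of an operator on the (finite dimensional) Hilbert space `ℋ`. -/
def tr (A : ℋ →L[ℂ] ℋ) : ℂ := LinearMap.trace ℂ ℋ (A : ℋ →ₗ[ℂ] ℋ)

/-- The duality bracket `⟨A | B⟩ = tr (A* B)`. -/
def bracket (A B : ℋ →L[ℂ] ℋ) : ℂ := tr (star A * B)

/-- Density matrices: positive operators of trace one. -/
structure IsState (ρ : ℋ →L[ℂ] ℋ) : Prop where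
  pos : ρ.IsPositive
  trace_one : tr ρ = 1

/-- An operator is faithful if its kernel is trivial. -/
def IsFaithful (ρ : ℋ →L[ℂ] ℋ) : Prop := ∀ v : ℋ, ρ v = 0 → v = 0

variable (ℋ) in
/-- A (chosen) representation of a Lindbladian: a self-adjoint Hamiltonian `H` and a finite
family of operators `Γ l`. -/
structure Lindbladian (κ : Type*) where
  H : ℋ →L[ℂ] ℋ
  Γ : κ → (ℋ →L[ℂ] ℋ)
  selfAdjoint_H : IsSelfAdjoint H

namespace Lindbladian

variable {κ : Type*} [Fintype κ] (L : Lindbladian ℋ κ)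

/-- The completely positive map `Φ(X) = ∑ l, Γ_l* X Γ_l` associated to the Lindbladian. -/
def Phi : (ℋ →L[ℂ] ℋ) →L[ℂ] (ℋ →L[ℂ] ℋ) :=
  ∑ l, ContinuousLinearMap.mulLeftRight ℂ (ℋ →L[ℂ] ℋ) (star (L.Γ l)) (L.Γ l)

theorem Phi_apply (X : ℋ →L[ℂ] ℋ) : L.Phi X = ∑ l, star (L.Γ l) * X * L.Γ l := by
  simp [Phi]

/-- The map `X ↦ ∑ l, Γ_l X Γ_l*`. -/
def jump : (ℋ →L[ℂ] ℋ) →L[ℂ] (ℋ →L[ℂ] ℋ) :=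
  ∑ l, ContinuousLinearMap.mulLeftRight ℂ (ℋ →L[ℂ] ℋ) (L.Γ l) (star (L.Γ l))

/-- Left multiplication by `A`. -/
abbrev mulL (A : ℋ →L[ℂ] ℋ) : (ℋ →L[ℂ] ℋ) →L[ℂ] (ℋ →L[ℂ] ℋ) :=
  ContinuousLinearMap.mul ℂ (ℋ →L[ℂ] ℋ) A

/-- Right multiplication by `A`. -/
abbrev mulR (A : ℋ →L[ℂ] ℋ) : (ℋ →L[ℂ] ℋ) →L[ℂ] (ℋ →L[ℂ] ℋ) :=
  (ContinuousLinearMap.mul ℂ (ℋ →L[ℂ] ℋ)).flip A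

/-- The super-operator
`X ↦ -i[H, X] + ∑ l, (Γ_l X Γ_l* - (1/2){Γ_l* Γ_l, X})`, see `gen_apply`. -/
def gen : (ℋ →L[ℂ] ℋ) →L[ℂ] (ℋ →L[ℂ] ℋ) :=
  (-Complex.I) • (mulL L.H - mulR L.H) + L.jump
    - (1 / 2 : ℂ) • (mulL (L.Phi 1) + mulR (L.Phi 1))

/-- The dual super-operator `X ↦ i[H, X] - (1/2){Φ(1), X} + Φ(X)`, see `dualGen_apply`; it is
the adjoint of `gen` for the duality bracket, see `bracket_gen`. -/
def dualGen : (ℋ →L[ℂ] ℋ) →L[ℂ] (ℋ →L[ℂ] ℋ) :=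
  Complex.I • (mulL L.H - mulR L.H) - (1 / 2 : ℂ) • (mulL (L.Phi 1) + mulR (L.Phi 1)) + L.Phi

theorem gen_apply (X : ℋ →L[ℂ] ℋ) :
    L.gen X = -(Complex.I • (L.H * X - X * L.H)) +
      ∑ l, (L.Γ l * X * star (L.Γ l) -
        (1 / 2 : ℂ) • (star (L.Γ l) * L.Γ l * X + X * (star (L.Γ l) * L.Γ l))) := by
  simp [gen, jump, Phi_apply, Finset.sum_sub_distrib, Finset.sum_mul, Finset.mul_sum,
    Finset.sum_add_distrib, ← Finset.smul_sum, add_sub_assoc]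

theorem dualGen_apply (X : ℋ →L[ℂ] ℋ) :
    L.dualGen X = Complex.I • (L.H * X - X * L.H)
      - (1 / 2 : ℂ) • (L.Phi 1 * X + X * L.Phi 1) + L.Phi X := by
  simp [dualGen]

theorem tr_mul_comm (A B : ℋ →L[ℂ] ℋ) : tr (A * B) = tr (B * A) :=
  LinearMap.trace_mul_comm ℂ (A : ℋ →ₗ[ℂ] ℋ) (B : ℋ →ₗ[ℂ] ℋ)

theorem tr_add (A B : ℋ →L[ℂ] ℋ) : tr (A + B) = tr A + tr B := by simp [tr]
theorem tr_sub (A B : ℋ →L[ℂ] ℋ) : tr (A - B) = tr A - tr B := by simp [tr]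
theorem tr_smul (c : ℂ) (A : ℋ →L[ℂ] ℋ) : tr (c • A) = c * tr A := by simp [tr]
theorem tr_sum (A : κ → (ℋ →L[ℂ] ℋ)) : tr (∑ l, A l) = ∑ l, tr (A l) := by
  simp [tr, ContinuousLinearMap.toLinearMap_sum]

theorem bracket_gen (A B : ℋ →L[ℂ] ℋ) : bracket (L.gen A) B = bracket A (L.dualGen B) := by
  have hH : star L.H = L.H := L.selfAdjoint_H
  have hP : star (L.Phi 1) = L.Phi 1 := by simp [Phi_apply]
  have hJ : tr (star (L.jump A) * B) = tr (star A * L.Phi B) := by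
    simp only [jump, Phi_apply, sum_apply, star_sum, Finset.sum_mul,
      Finset.mul_sum, tr_sum]
    refine Finset.sum_congr rfl fun l _ => ?_
    simp only [ContinuousLinearMap.mulLeftRight_apply, star_mul, star_star]
    rw [mul_assoc, tr_mul_comm]
    simp only [mul_assoc]
  have e1 : tr (star A * L.H * B) = tr (star A * (L.H * B)) := by rw [mul_assoc]
  have e2 : tr (L.H * star A * B) = tr (star A * (B * L.H)) := by
    rw [mul_assoc, tr_mul_comm, mul_assoc]
  have e3 : tr (star A * L.Phi 1 * B) = tr (star A * (L.Phi 1 * B)) := by rw [mul_assoc]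
  have e4 : tr (L.Phi 1 * star A * B) = tr (star A * (B * L.Phi 1)) := by
    rw [mul_assoc, tr_mul_comm, mul_assoc]
  have hs : star (L.gen A) = Complex.I • (star A * L.H - L.H * star A) + star (L.jump A)
      - (1 / 2 : ℂ) • (star A * L.Phi 1 + L.Phi 1 * star A) := by
    simp [gen, hH, hP]
  rw [bracket, bracket, hs, dualGen_apply]
  simp only [add_mul, sub_mul, mul_add, mul_sub, smul_mul_assoc, mul_smul_comm, tr_add, tr_sub,
    tr_smul, e1, e2, e3, e4, hJ]
  ring

/-- The Markov quantum dynamics `e^{tL}`. -/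
def evol (t : ℝ) : (ℋ →L[ℂ] ℋ) →L[ℂ] (ℋ →L[ℂ] ℋ) := NormedSpace.exp ((t : ℂ) • L.gen)

/-- Detailed balance for the pair `(ρ, L)`: `ρ` is a faithful steady state and `Φ` is
self-adjoint for the inner product `⟨A | B⟩_ρ = tr (ρ A* B)`. -/
structure DetailedBalance (ρ : ℋ →L[ℂ] ℋ) : Prop where
  state : IsState ρ
  steady : L.gen ρ = 0
  faithful : IsFaithful ρ
  selfAdjoint_Phi : ∀ A B : ℋ →L[ℂ] ℋ, tr (ρ * star A * L.Phi B) = tr (ρ * star (L.Phi A) * B)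

end Lindbladian

section Measurement

variable [FiniteDimensional ℂ ℋ]

/-- The spectral projection `P_s` of a self-adjoint `S`: the orthogonal projection onto
`ker (S - s)`. -/
def specProj (S : ℋ →L[ℂ] ℋ) (s : ℝ) : ℋ →L[ℂ] ℋ :=
  (Module.End.eigenspace (S : ℋ →ₗ[ℂ] ℋ) (s : ℂ)).starProjection

theorem finite_spectrum (S : ℋ →L[ℂ] ℋ) : (spectrum ℝ S).Finite := by
  have h : (spectrum ℂ S).Finite := by
    have h1 := AlgEquiv.spectrum_eq (Module.End.toContinuousLinearMap (𝕜 := ℂ) ℋ) (S : ℋ →ₗ[ℂ] ℋ)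
    have h2 : Module.End.toContinuousLinearMap (𝕜 := ℂ) ℋ (S : ℋ →ₗ[ℂ] ℋ) = S := by
      ext v; rfl
    rw [h2] at h1
    rw [h1]
    exact Module.End.finite_spectrum _
  rw [← spectrum.preimage_algebraMap (S := ℂ)]
  exact h.preimage (FaithfulSMul.algebraMap_injective ℝ ℂ).injOn

/-- The spectrum of a self-adjoint `S`, as a finite set of real numbers. -/
def spec (S : ℋ →L[ℂ] ℋ) : Finset ℝ := (finite_spectrum S).toFinset

variable {κ : Type*} [Fintype κ]

/-- The joint probability `⟨e^{tL}(P_s ρ₀ P_s) | P_{s'}⟩` of the outcome `s` of a measurement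
of `S` at time `0` and the outcome `s'` of a second measurement of `S` at time `t`. -/
def jointProb (L : Lindbladian ℋ κ) (S ρ₀ : ℋ →L[ℂ] ℋ) (t s s' : ℝ) : ℝ :=
  (bracket (L.evol t (specProj S s * ρ₀ * specProj S s)) (specProj S s')).re

/-- The law of the variation `ΔS = s' - s` in the two-time measurement of `S`. -/
def twoTimeLaw (L : Lindbladian ℋ κ) (S ρ₀ : ℋ →L[ℂ] ℋ) (t : ℝ) : Measure ℝ :=
  ∑ s ∈ spec S, ∑ s' ∈ spec S,
    ENNReal.ofReal (jointProb L S ρ₀ t s s') • Measure.dirac (s' - s)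

/-- The expected value of `ΔS` in the two-time measurement of `S`. -/
def twoTimeExpectation (L : Lindbladian ℋ κ) (S ρ₀ : ℋ →L[ℂ] ℋ) (t : ℝ) : ℝ :=
  ∫ σ, σ ∂(twoTimeLaw L S ρ₀ t)

end Measurement

section Entropy

/-- The von Neumann entropy `-⟨ρ | log ρ⟩`, where `0 log 0 = 0`. -/
def vnEntropy (ρ : ℋ →L[ℂ] ℋ) : ℝ := -(bracket ρ (CFC.log ρ)).re

open scoped Classical in
/-- The relative entropy `Ent(μ|ν)`; in the first case the value that `CFC.log` takes on the
kernels of `μ` and `ν` does not contribute. -/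
def relEntropy (μ ν : ℋ →L[ℂ] ℋ) : EReal :=
  if ∀ v : ℋ, ν v = 0 → μ v = 0 then (((bracket μ (CFC.log μ - CFC.log ν)).re : ℝ) : EReal) else ⊤

variable {κ : Type*} [Fintype κ]

/-- The quotient whose limit as `h ↓ 0` is minus the derivative at `0` of
`h ↦ Ent(e^{hL}(ρ)|ρ⁺)`. -/
def epQuotient (L : Lindbladian ℋ κ) (ρplus ρ : ℋ →L[ℂ] ℋ) (h : ℝ) : EReal :=
  (relEntropy ρ ρplus - relEntropy (L.evol h ρ) ρplus) / (h : EReal)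

/-- The entropy production (rate) in the state `ρ`, relative to the steady state `ρ⁺`, namely
minus the (right) derivative at `0` of `h ↦ Ent(e^{hL}(ρ)|ρ⁺)`; it can be `+∞`. -/
def entropyProduction (L : Lindbladian ℋ κ) (ρplus ρ : ℋ →L[ℂ] ℋ) : EReal :=
  limUnder (𝓝[>] (0 : ℝ)) (epQuotient L ρplus ρ)

end Entropy

end

end OpenQS

/-! Two independent arguments meet here. The first is algebraic. Detailed balance forces `Φ` to
preserve the commutant of `ρ⁺` (`commute_Phi`) and forces `H` to commute with `ρ⁺` (`commute_H`), so
`e^{tL†}` preserves that commutant. If `B` commutes with `ρ⁺`, then `D = e^{tL†}(B)` commutes with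
every `P_s`, hence `∑ P_s D P_s = D`: the first measurement is invisible to `B`
(`sum_bracket_evol`). With `B = P_{s'}` this is (i), with `B = S⁺` it gives (ii), and the flux
formula is the fundamental theorem of calculus.

The second argument is the entropy balance. As `ρ⁺` is faithful, `Ent(μ|ρ⁺) = -S(μ) + ⟨μ|S⁺⟩`, and
only the right derivative of `S` along the flow is delicate. In an eigenbasis of `ρ`, the diagonal
entries of `-A log A` for `A = e^{hL}(ρ)` are squeezed between an affine and a quadratic
minorant/majorant of `-x log x` touching at the eigenvalue, which avoids perturbation theory for
eigenvalues. The slope diverges exactly when the kernel gains mass at first order (`entropy_slope`).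
At positive times it cannot: `⟨v|ρ_u v⟩` is nonnegative and vanishes at an interior time, so its
derivative is zero.

The finite right derivatives are bounded below by a constant. Together with continuity of the
entropy up to time `0`, this yields integrability and the integral formula (`entropy_balance`), even
if the entropy production is infinite at time `0`. -/

namespace OpenQS

/-! ### Product approximation of exponentials in a Banach algebra. -/

section BanachAlgebra

variable {A : Type*} [NormedRing A]

/-- Telescoping for noncommuting elements: this is how local errors of an approximation scheme
accumulate over `n` steps. -/
theorem norm_pow_sub_pow_le [NormOneClass A] {a b : A} {M : ℝ} (hM : 1 ≤ M) (ha : ‖a‖ ≤ M) (hb : ‖b‖ ≤ M) (n : ℕ) :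
    ‖a ^ n - b ^ n‖ ≤ n * M ^ n * ‖a - b‖ := by
  induction n with
  | zero => simp
  | succ n ih =>
    have hM0 : 0 ≤ M := zero_le_one.trans hM
    have e : a ^ (n + 1) - b ^ (n + 1) = a ^ n * (a - b) + (a ^ n - b ^ n) * b := by
      rw [pow_succ, pow_succ]; noncomm_ring
    have h1 : ‖a ^ n‖ ≤ M ^ (n + 1) := by
      refine (norm_pow_le a n).trans ((pow_le_pow_left₀ (norm_nonneg a) ha n).trans ?_)
      exact pow_le_pow_right₀ hM n.le_succ
    calc ‖a ^ (n + 1) - b ^ (n + 1)‖ ≤ ‖a ^ n‖ * ‖a - b‖ + ‖a ^ n - b ^ n‖ * ‖b‖ := by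
          rw [e]
          exact (norm_add_le _ _).trans (add_le_add (norm_mul_le _ _) (norm_mul_le _ _))
      _ ≤ M ^ (n + 1) * ‖a - b‖ + (n * M ^ n * ‖a - b‖) * M := by gcongr
      _ = ((n + 1 : ℕ) : ℝ) * M ^ (n + 1) * ‖a - b‖ := by push_cast; ring

variable [NormedAlgebra ℂ A] [CompleteSpace A]

theorem exp_sub_one_sub_isBigO (x : A) :
    (fun h : ℝ => NormedSpace.exp ((h : ℂ) • x) - (1 + (h : ℂ) • x)) =O[𝓝 0] fun h => h ^ 2 := by
  have h := (NormedSpace.exp_hasFPowerSeriesAt_zero (𝕂 := ℂ) (𝔸 := A)).isBigO_sub_partialSum_pow 2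
  have hl : Tendsto (fun h : ℝ => (h : ℂ) • x) (𝓝 0) (𝓝 0) := by
    have : Continuous fun h : ℝ => (h : ℂ) • x := by fun_prop
    simpa using this.tendsto 0
  have h2 := h.comp_tendsto hl
  have h3 : (fun h : ℝ => ‖(h : ℂ) • x‖ ^ 2) =O[𝓝 0] fun h : ℝ => h ^ 2 := by
    refine Asymptotics.IsBigO.of_bound (‖x‖ ^ 2) (Eventually.of_forall fun h => ?_)
    simp [norm_smul, mul_pow, mul_comm]
  refine (h2.trans h3).congr_left fun h => ?_
  simp [FormalMultilinearSeries.partialSum, Finset.sum_range_succ, NormedSpace.expSeries_apply_eq]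

theorem norm_exp_le [NormOneClass A] (x : A) : ‖NormedSpace.exp x‖ ≤ Real.exp ‖x‖ := by
  have h1 := NormedSpace.exp_series_hasSum_exp' (𝕂 := ℂ) x
  have h2 := NormedSpace.exp_series_hasSum_exp' (𝕂 := ℝ) ‖x‖
  rw [← Real.exp_eq_exp_ℝ] at h2
  refine h1.norm_le_of_bounded h2 fun n => ?_
  rw [norm_smul, smul_eq_mul, norm_inv, Complex.norm_natCast]
  gcongr
  exact norm_pow_le _ _

/-- The iterates of a second order perturbation of `1 + h x` approximate the exponential. -/
theorem tendsto_pow_exp [NormOneClass A] (x k : A) {t : ℝ} (ht : 0 ≤ t) :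
    Tendsto (fun n : ℕ => (1 + ((t / n : ℝ) : ℂ) • x + (((t / n : ℝ) : ℂ) ^ 2) • k) ^ n) atTop
      (𝓝 (NormedSpace.exp ((t : ℂ) • x))) := by
  set T : ℝ → A := fun h => 1 + (h : ℂ) • x + ((h : ℂ) ^ 2) • k with hT
  -- Since `h ≤ t`, the second order term obeys `h² ‖k‖ ≤ h t ‖k‖`, so one step of either scheme has
  -- norm at most `exp (h c)` and `n` steps at most `exp (t c)`. Each step errs by `O(h²)`, in total
  -- `O(t²/n)`.
  set c : ℝ := ‖x‖ + t * ‖k‖ with hc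
  have hc0 : 0 ≤ c := by positivity
  have hO : (fun h : ℝ => T h - NormedSpace.exp ((h : ℂ) • x)) =O[𝓝 0] fun h => h ^ 2 := by
    have h1 : (fun h : ℝ => ((h : ℂ) ^ 2) • k) =O[𝓝 0] fun h => h ^ 2 := by
      refine Asymptotics.IsBigO.of_bound ‖k‖ (Eventually.of_forall fun h => ?_)
      simp [norm_smul, mul_comm]
    refine (h1.sub (exp_sub_one_sub_isBigO x)).congr_left fun h => ?_
    simp only [hT]; abel
  obtain ⟨C, hC⟩ := hO.bound
  have htn : Tendsto (fun n : ℕ => t / n) atTop (𝓝 0) := tendsto_const_div_atTop_nhds_zero_nat t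
  rw [tendsto_iff_norm_sub_tendsto_zero]
  have hlim : Tendsto (fun n : ℕ => Real.exp (t * c) * C * t * (t / n)) atTop (𝓝 0) := by
    simpa using htn.const_mul (Real.exp (t * c) * C * t)
  refine squeeze_zero' (Eventually.of_forall fun _ => norm_nonneg _) ?_ hlim
  filter_upwards [htn.eventually hC, eventually_ge_atTop 1] with n hn hn1
  have hn0 : (0 : ℝ) < n := by exact_mod_cast hn1
  have hh0 : 0 ≤ t / n := by positivity
  have hht : t / n ≤ t := div_le_self ht (by exact_mod_cast hn1)
  have hnh : (n : ℝ) * (t / n) = t := by field_simp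
  set h := t / n
  have hM : 1 ≤ Real.exp (h * c) := Real.one_le_exp (by positivity)
  have ha : ‖T h‖ ≤ Real.exp (h * c) := by
    have h1 : ‖T h‖ ≤ 1 + h * ‖x‖ + h ^ 2 * ‖k‖ := by
      refine (norm_add₃_le).trans ?_
      simp [norm_smul, abs_of_nonneg hh0]
    have h2 : h ^ 2 * ‖k‖ ≤ h * t * ‖k‖ := by rw [pow_two]; gcongr
    have h3 := Real.add_one_le_exp (h * c)
    rw [hc] at h3 ⊢
    nlinarith
  have hb : ‖NormedSpace.exp ((h : ℂ) • x)‖ ≤ Real.exp (h * c) := by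
    refine (norm_exp_le _).trans (Real.exp_le_exp.2 ?_)
    rw [norm_smul, Complex.norm_real, Real.norm_of_nonneg hh0]
    gcongr
    rw [hc]
    have : 0 ≤ t * ‖k‖ := by positivity
    linarith
  have he : NormedSpace.exp ((t : ℂ) • x) = NormedSpace.exp ((h : ℂ) • x) ^ n := by
    let _ := NormedAlgebra.restrictScalars ℚ ℂ A
    rw [← NormedSpace.exp_nsmul, ← hnh]
    congr 1
    rw [← Nat.cast_smul_eq_nsmul ℂ, smul_smul]; push_cast; rfl
  rw [he]
  refine (norm_pow_sub_pow_le hM ha hb n).trans ?_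
  have hpow : Real.exp (h * c) ^ n = Real.exp (t * c) := by
    rw [← Real.exp_nat_mul, ← mul_assoc, hnh]
  rw [hpow]
  have hn' : ‖T h - NormedSpace.exp ((h : ℂ) • x)‖ ≤ C * h ^ 2 := by
    simpa [abs_of_nonneg hh0] using hn
  calc (n : ℝ) * Real.exp (t * c) * ‖T h - NormedSpace.exp ((h : ℂ) • x)‖
      ≤ n * Real.exp (t * c) * (C * h ^ 2) := by gcongr
    _ = Real.exp (t * c) * C * (n * h) * h := by ring
    _ = Real.exp (t * c) * C * t * h := by rw [hnh]

end BanachAlgebra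

/-! ### Exponentials of bounded operators acting on vectors. -/

section ExpInvariance

variable {E : Type*} [NormedAddCommGroup E] [NormedSpace ℂ E] [CompleteSpace E]

theorem hasSum_exp_apply (T : E →L[ℂ] E) (x : E) :
    HasSum (fun n : ℕ => ((n.factorial : ℂ)⁻¹) • (T ^ n) x) (NormedSpace.exp T x) := by
  have h := NormedSpace.exp_series_hasSum_exp' (𝕂 := ℂ) T
  exact h.mapL (ContinuousLinearMap.apply ℂ E x)

theorem exp_apply_mem [FiniteDimensional ℂ E] (T : E →L[ℂ] E) (W : Submodule ℂ E)
    (hT : ∀ x ∈ W, T x ∈ W) {x : E} (hx : x ∈ W) : NormedSpace.exp T x ∈ W := by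
  have hp : ∀ n : ℕ, (T ^ n) x ∈ W := by
    intro n
    induction n with
    | zero => simpa using hx
    | succ n ih => rw [pow_succ']; exact hT _ ih
  refine W.closed_of_finiteDimensional.mem_of_tendsto (hasSum_exp_apply T x)
    (Eventually.of_forall fun s => ?_)
  exact W.sum_mem fun n _ => W.smul_mem _ (hp n)

theorem exp_zero_smul_apply (T : E →L[ℂ] E) (x : E) :
    NormedSpace.exp (((0 : ℝ) : ℂ) • T) x = x := by simp

theorem exp_smul_exp_smul_apply (T : E →L[ℂ] E) (s t : ℝ) (x : E) :
    NormedSpace.exp ((s : ℂ) • T) (NormedSpace.exp ((t : ℂ) • T) x) =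
      NormedSpace.exp (((t + s : ℝ) : ℂ) • T) x := by
  let _ := NormedAlgebra.restrictScalars ℚ ℂ (E →L[ℂ] E)
  have : NormedSpace.exp (((t + s : ℝ) : ℂ) • T) =
      NormedSpace.exp ((s : ℂ) • T) * NormedSpace.exp ((t : ℂ) • T) := by
    rw [← NormedSpace.exp_add_of_commute]
    · rw [← add_smul]; push_cast; rw [add_comm]
    · exact ((Commute.refl T).smul_left _).smul_right _
  rw [this]; rfl

theorem hasDerivAt_exp_smul_apply (T : E →L[ℂ] E) (x : E) (s : ℝ) :
    HasDerivAt (fun u : ℝ => NormedSpace.exp ((u : ℂ) • T) x)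
      (T (NormedSpace.exp ((s : ℂ) • T) x)) s := by
  have h := (hasDerivAt_exp_smul_const' (𝕂 := ℂ) T (s : ℂ)).scomp s
    Complex.ofRealCLM.hasDerivAt
  have h2 := (((ContinuousLinearMap.apply ℂ E x).restrictScalars ℝ).hasFDerivAt
    ).comp_hasDerivAt s h
  simpa [Function.comp_def] using h2

theorem tendsto_pow_exp_apply [Nontrivial E] (T K : E →L[ℂ] E) {t : ℝ} (ht : 0 ≤ t) (x : E) :
    Tendsto (fun n : ℕ =>
      ((fun y => y + ((t / n : ℝ) : ℂ) • T y + (((t / n : ℝ) : ℂ) ^ 2) • K y)^[n]) x) atTop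
      (𝓝 (NormedSpace.exp ((t : ℂ) • T) x)) := by
  have hlim := ((ContinuousLinearMap.apply ℂ E x).continuous.tendsto _).comp
    (tendsto_pow_exp T K ht)
  refine hlim.congr fun n => ?_
  have hP : ∀ P : E →L[ℂ] E, (P ^ n) x = P^[n] x := fun P => by simp
  exact hP _

theorem exp_smul_apply_isBigO [Nontrivial E] (T : E →L[ℂ] E) (x : E) :
    (fun h : ℝ => NormedSpace.exp ((h : ℂ) • T) x - (x + (h : ℂ) • T x)) =O[𝓝 0]
      fun h => h ^ 2 :=
  ((ContinuousLinearMap.apply ℂ E x).isBigO_comp _ _).trans (exp_sub_one_sub_isBigO T)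

theorem exp_smul_apply_eq_self (T : E →L[ℂ] E) {x : E} (h : T x = 0) (t : ℝ) :
    NormedSpace.exp ((t : ℂ) • T) x = x := by
  refine (hasSum_exp_apply ((t : ℂ) • T) x).unique ?_
  convert hasSum_single (α := E) 0 ?_ using 1
  · simp
  · intro n hn
    obtain ⟨m, rfl⟩ := Nat.exists_eq_succ_of_ne_zero hn
    rw [pow_succ, mul_apply_eq_comp, show ((t : ℂ) • T) x = (t : ℂ) • T x from rfl, h, smul_zero,
      map_zero, smul_zero]

/-- Operators that are adjoint for a family of functionals have adjoint exponentials. -/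
theorem exp_smul_adjoint (T T' : E →L[ℂ] E) (b : E →L⋆[ℂ] E →L[ℂ] ℂ)
    (h : ∀ x y, b (T x) y = b x (T' y)) (t : ℝ) (x y : E) :
    b (NormedSpace.exp ((t : ℂ) • T) x) y = b x (NormedSpace.exp ((t : ℂ) • T') y) := by
  have hpow : ∀ (n : ℕ) (x : E),
      b ((((t : ℂ) • T) ^ n) x) y = b x ((((t : ℂ) • T') ^ n) y) := by
    intro n
    induction n with
    | zero => intro x; simp
    | succ n ih =>
      intro x
      have e1 : (((t : ℂ) • T) ^ (n + 1)) x = (((t : ℂ) • T) ^ n) ((t : ℂ) • T x) := by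
        rw [pow_succ]; rfl
      have e2 : (((t : ℂ) • T') ^ (n + 1)) y = (t : ℂ) • T' ((((t : ℂ) • T') ^ n) y) := by
        rw [pow_succ']; rfl
      rw [e1, e2, ih, map_smulₛₗ, smul_apply, h, map_smul, Complex.conj_ofReal]
  have h1 := (hasSum_exp_apply ((t : ℂ) • T) x).map (b.flip y) (b.flip y).continuous
  have h2 := (hasSum_exp_apply ((t : ℂ) • T') y).mapL (b x)
  refine h1.unique (h2.congr_fun fun n => ?_)
  simp only [Function.comp_apply, ContinuousLinearMap.flip_apply]
  rw [map_smulₛₗ, map_smul, smul_apply, hpow]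
  simp

end ExpInvariance

/-! ### The trace and the duality bracket. -/

section Trace

variable {ℋ : Type*} [NormedAddCommGroup ℋ] [InnerProductSpace ℂ ℋ] [CompleteSpace ℋ]
  [FiniteDimensional ℂ ℋ]

/-- The trace as a continuous linear functional. -/
noncomputable def trCLM : (ℋ →L[ℂ] ℋ) →L[ℂ] ℂ :=
  LinearMap.toContinuousLinearMap
    ({ toFun := tr, map_add' := Lindbladian.tr_add, map_smul' := Lindbladian.tr_smul } :
      (ℋ →L[ℂ] ℋ) →ₗ[ℂ] ℂ)

theorem trCLM_apply (A : ℋ →L[ℂ] ℋ) : trCLM A = tr A := rfl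

theorem tr_eq_sum_inner {ι : Type*} [Fintype ι] (b : OrthonormalBasis ι ℂ ℋ) (A : ℋ →L[ℂ] ℋ) :
    tr A = ∑ i, inner ℂ (b i) (A (b i)) :=
  LinearMap.trace_eq_sum_inner _ b

theorem tr_star (A : ℋ →L[ℂ] ℋ) : tr (star A) = star (tr A) := by
  rw [tr_eq_sum_inner (stdOrthonormalBasis ℂ ℋ), tr_eq_sum_inner (stdOrthonormalBasis ℂ ℋ),
    star_sum]
  refine Finset.sum_congr rfl fun i _ => ?_
  rw [ContinuousLinearMap.star_eq_adjoint, ContinuousLinearMap.adjoint_inner_right]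
  exact (inner_conj_symm _ _).symm

/-- The duality bracket as a continuous sesquilinear form. -/
noncomputable def bracketCLM : (ℋ →L[ℂ] ℋ) →L⋆[ℂ] (ℋ →L[ℂ] ℋ) →L[ℂ] ℂ :=
  LinearMap.mkContinuous₂
    (LinearMap.mk₂'ₛₗ (starRingEnd ℂ) (RingHom.id ℂ) bracket
      (fun A A' B => by simp [bracket, add_mul, Lindbladian.tr_add])
      (fun c A B => by simp [bracket, Lindbladian.tr_smul])
      (fun A B B' => by simp [bracket, mul_add, Lindbladian.tr_add])
      (fun c A B => by simp [bracket, Lindbladian.tr_smul]))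
    ‖(trCLM : (ℋ →L[ℂ] ℋ) →L[ℂ] ℂ)‖ fun A B => by
      refine (trCLM.le_opNorm (star A * B)).trans ?_
      rw [mul_assoc]
      gcongr
      exact (norm_mul_le _ _).trans_eq (by rw [norm_star])

theorem bracketCLM_apply (A B : ℋ →L[ℂ] ℋ) : bracketCLM A B = bracket A B := rfl

theorem star_bracket (A B : ℋ →L[ℂ] ℋ) : star (bracket A B) = bracket B A := by
  rw [bracket, bracket, ← tr_star, star_mul, star_star]

theorem bracket_self_star {A B : ℋ →L[ℂ] ℋ} (hA : IsSelfAdjoint A) (hB : IsSelfAdjoint B) :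
    ((bracket A B).re : ℂ) = bracket A B := by
  apply Complex.conj_eq_iff_re.1
  change star (bracket A B) = _
  rw [star_bracket, bracket, bracket, hA.star_eq, hB.star_eq, Lindbladian.tr_mul_comm]

/-- Writing `B = C* C`, cyclicity turns the bracket into the trace of the positive operator `C A
C*`. -/
theorem bracket_nonneg {A B : ℋ →L[ℂ] ℋ} (hA : 0 ≤ A) (hB : 0 ≤ B) : 0 ≤ (bracket A B).re := by
  obtain ⟨C, hC⟩ := CStarAlgebra.nonneg_iff_eq_star_mul_self.1 hB
  have hA' : star A = A := (IsSelfAdjoint.of_nonneg hA).star_eq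
  rw [bracket, hA', hC, ← mul_assoc, Lindbladian.tr_mul_comm, ← mul_assoc,
    tr_eq_sum_inner (stdOrthonormalBasis ℂ ℋ), Complex.re_sum]
  refine Finset.sum_nonneg fun i _ => ?_
  have : 0 ≤ C * A * star C := star_right_conjugate_nonneg hA C
  exact ((ContinuousLinearMap.nonneg_iff_isPositive _).1 this).re_inner_nonneg_right _

theorem eq_zero_of_bracket {A : ℋ →L[ℂ] ℋ} (h : ∀ B, bracket B A = 0) : A = 0 := by
  have h1 := h A
  rw [bracket, tr_eq_sum_inner (stdOrthonormalBasis ℂ ℋ)] at h1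
  have h2 : ∀ i, inner ℂ (stdOrthonormalBasis ℂ ℋ i) ((star A * A) (stdOrthonormalBasis ℂ ℋ i)) =
      ((‖A (stdOrthonormalBasis ℂ ℋ i)‖ ^ 2 : ℝ) : ℂ) := by
    intro i
    rw [ContinuousLinearMap.star_eq_adjoint, mul_apply_eq_comp,
      ContinuousLinearMap.adjoint_inner_right, inner_self_eq_norm_sq_to_K]
    norm_cast
  simp only [h2] at h1
  rw [← Complex.ofReal_sum, Complex.ofReal_eq_zero,
    Finset.sum_eq_zero_iff_of_nonneg fun _ _ => by positivity] at h1
  apply ContinuousLinearMap.coe_injective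
  refine (stdOrthonormalBasis ℂ ℋ).toBasis.ext fun i => ?_
  have := h1 i (Finset.mem_univ i)
  simpa using this

end Trace

/-! ### The semigroup preserves positivity and trace. -/

namespace Lindbladian

variable {ℋ : Type*} [NormedAddCommGroup ℋ] [InnerProductSpace ℂ ℋ] [CompleteSpace ℋ]
  {κ : Type*} [Fintype κ] (L : Lindbladian ℋ κ)

/-- The dual evolution `e^{tL†}`. -/
noncomputable def dualEvol (t : ℝ) : (ℋ →L[ℂ] ℋ) →L[ℂ] (ℋ →L[ℂ] ℋ) :=
  NormedSpace.exp ((t : ℂ) • L.dualGen)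

theorem evol_zero (X : ℋ →L[ℂ] ℋ) : L.evol 0 X = X := exp_zero_smul_apply L.gen X

theorem evol_add (s t : ℝ) (X : ℋ →L[ℂ] ℋ) : L.evol s (L.evol t X) = L.evol (t + s) X :=
  exp_smul_exp_smul_apply L.gen s t X

theorem hasDerivAt_evol (X : ℋ →L[ℂ] ℋ) (s : ℝ) :
    HasDerivAt (fun u => L.evol u X) (L.gen (L.evol s X)) s :=
  hasDerivAt_exp_smul_apply L.gen X s

theorem continuous_evol (X : ℋ →L[ℂ] ℋ) : Continuous fun u => L.evol u X :=
  continuous_iff_continuousAt.2 fun s => (L.hasDerivAt_evol X s).continuousAt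

theorem star_Phi (X : ℋ →L[ℂ] ℋ) : star (L.Phi X) = L.Phi (star X) := by
  simp [Phi_apply, mul_assoc]

theorem dualGen_one : L.dualGen 1 = 0 := by
  rw [dualGen_apply]
  simp only [mul_one, one_mul, sub_self, smul_zero, ← two_smul ℂ (L.Phi 1), smul_smul]
  norm_num

/-- The operator `G` in `L(X) = G X + X G* + ∑ l, Γ_l X Γ_l*`. -/
noncomputable def drift : ℋ →L[ℂ] ℋ := -(Complex.I • L.H) - (1 / 2 : ℂ) • L.Phi 1

theorem star_drift : star L.drift = Complex.I • L.H - (1 / 2 : ℂ) • L.Phi 1 := by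
  have hH : star L.H = L.H := L.selfAdjoint_H
  simp [drift, hH, star_Phi]

theorem jump_apply (X : ℋ →L[ℂ] ℋ) : L.jump X = ∑ l, L.Γ l * X * star (L.Γ l) := by
  simp [jump]

theorem gen_eq_drift (X : ℋ →L[ℂ] ℋ) :
    L.gen X = L.drift * X + X * star L.drift + L.jump X := by
  rw [star_drift, drift]
  change (-Complex.I) • (L.H * X - X * L.H) + L.jump X
    - (1 / 2 : ℂ) • (L.Phi 1 * X + X * L.Phi 1) = _
  simp only [sub_mul, mul_sub, neg_mul, smul_mul_assoc, mul_smul_comm, smul_add, smul_sub, neg_smul]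
  abel

theorem jump_nonneg {X : ℋ →L[ℂ] ℋ} (hX : 0 ≤ X) : 0 ≤ L.jump X := by
  rw [jump_apply]
  exact Finset.sum_nonneg fun l _ => star_right_conjugate_nonneg hX _

/-- With `G` the drift, `(1 + hG) Y (1 + hG)* + h J(Y)` is manifestly positive and differs from `Y +
h L(Y)` by exactly `h² G Y G*`. Iterating this corrected Euler step converges to the semigroup, and
the positive cone is closed. -/
theorem evol_nonneg [Nontrivial ℋ] {X : ℋ →L[ℂ] ℋ} (hX : 0 ≤ X) {t : ℝ} (ht : 0 ≤ t) :
    0 ≤ L.evol t X := by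
  set K : (ℋ →L[ℂ] ℋ) →L[ℂ] (ℋ →L[ℂ] ℋ) :=
    ContinuousLinearMap.mulLeftRight ℂ (ℋ →L[ℂ] ℋ) L.drift (star L.drift)
  refine ge_of_tendsto' (tendsto_pow_exp_apply L.gen K ht X) fun n => ?_
  have hh : 0 ≤ t / n := by positivity
  set h := t / n
  have hstep : ∀ Y : ℋ →L[ℂ] ℋ, 0 ≤ Y →
      0 ≤ Y + (h : ℂ) • L.gen Y + ((h : ℂ) ^ 2) • K Y := by
    intro Y hY
    have e : Y + (h : ℂ) • L.gen Y + ((h : ℂ) ^ 2) • K Y =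
        (1 + (h : ℂ) • L.drift) * Y * star (1 + (h : ℂ) • L.drift) + h • L.jump Y := by
      rw [gen_eq_drift, show K Y = L.drift * Y * star L.drift from
        ContinuousLinearMap.mulLeftRight_apply _ _ _ _ _, ← Complex.coe_smul h (L.jump Y)]
      simp only [star_add, star_one,
        star_smul, add_mul, mul_add, one_mul, mul_one, smul_mul_assoc, mul_smul_comm, smul_add,
        smul_smul, Complex.star_def, Complex.conj_ofReal, pow_two]
      abel
    rw [e]
    exact add_nonneg (star_right_conjugate_nonneg hY _) (smul_nonneg hh (L.jump_nonneg hY))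
  have key : ∀ (m : ℕ) (Y : ℋ →L[ℂ] ℋ), 0 ≤ Y →
      0 ≤ (fun Y => Y + (h : ℂ) • L.gen Y + ((h : ℂ) ^ 2) • K Y)^[m] Y := by
    intro m
    induction m with
    | zero => intro Y hY; simpa using hY
    | succ m ih => intro Y hY; exact ih _ (hstep _ hY)
  exact key n X hX

variable [FiniteDimensional ℂ ℋ]

theorem bracket_evol (t : ℝ) (A B : ℋ →L[ℂ] ℋ) :
    bracket (L.evol t A) B = bracket A (L.dualEvol t B) :=
  exp_smul_adjoint L.gen L.dualGen bracketCLM L.bracket_gen t A B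

theorem tr_evol (t : ℝ) (A : ℋ →L[ℂ] ℋ) : tr (L.evol t A) = tr A := by
  have h1 : L.dualEvol t 1 = 1 := exp_smul_apply_eq_self L.dualGen L.dualGen_one t
  have h2 := L.bracket_evol t A 1
  rw [h1, bracket, bracket, mul_one, mul_one, tr_star, tr_star] at h2
  exact star_injective h2

end Lindbladian

theorem IsState.nontrivial {ℋ : Type*} [NormedAddCommGroup ℋ] [InnerProductSpace ℂ ℋ]
    {ρ : ℋ →L[ℂ] ℋ} (h : IsState ρ) : Nontrivial ℋ := by
  by_contra hn
  rw [not_nontrivial_iff_subsingleton] at hn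
  have : ρ = 0 := Subsingleton.elim _ _
  have h1 := h.trace_one
  simp [this, tr] at h1

theorem IsState.evol {ℋ : Type*} [NormedAddCommGroup ℋ] [InnerProductSpace ℂ ℋ]
    [CompleteSpace ℋ] [FiniteDimensional ℂ ℋ] {κ : Type*} [Fintype κ] (L : Lindbladian ℋ κ)
    {ρ : ℋ →L[ℂ] ℋ} (h : IsState ρ) {t : ℝ} (ht : 0 ≤ t) : IsState (L.evol t ρ) := by
  have := h.nontrivial
  refine ⟨?_, by rw [L.tr_evol, h.trace_one]⟩
  rw [← ContinuousLinearMap.nonneg_iff_isPositive]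
  exact L.evol_nonneg ((ContinuousLinearMap.nonneg_iff_isPositive _).2 h.pos) ht

/-! ### Spectral projections through the functional calculus. -/

section SpectralProjections

variable {ℋ : Type*} [NormedAddCommGroup ℋ] [InnerProductSpace ℂ ℋ] [CompleteSpace ℋ]
  [FiniteDimensional ℂ ℋ]

theorem continuousOn_spectrum (S : ℋ →L[ℂ] ℋ) (f : ℝ → ℝ) : ContinuousOn f (spectrum ℝ S) :=
  (finite_spectrum S).continuousOn f

theorem mem_spec {S : ℋ →L[ℂ] ℋ} {s : ℝ} : s ∈ spec S ↔ s ∈ spectrum ℝ S :=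
  (finite_spectrum S).mem_toFinset

theorem specProj_eq_cfc {S : ℋ →L[ℂ] ℋ} (hS : IsSelfAdjoint S) (s : ℝ) :
    specProj S s = cfc (fun x : ℝ => if x = s then 1 else 0) S := by
  set P := cfc (fun x : ℝ => if x = s then (1 : ℝ) else 0) S with hP
  have hSP : S * P = (s : ℂ) • P := by
    rw [Complex.coe_smul]
    conv_lhs => enter [1]; rw [← cfc_id ℝ S]
    rw [hP, ← cfc_mul _ _ S (continuousOn_spectrum _ _) (continuousOn_spectrum _ _),
      ← cfc_smul s _ S (continuousOn_spectrum _ _)]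
    refine cfc_congr fun x _ => ?_
    by_cases h : x = s <;> simp [h]
  have hPP : P * P = P := by
    rw [hP, ← cfc_mul _ _ S (continuousOn_spectrum _ _) (continuousOn_spectrum _ _)]
    refine cfc_congr fun x _ => ?_
    by_cases h : x = s <;> simp [h]
  -- The convention `0⁻¹ = 0` makes the product the indicator of `x ≠ s`; hence `P` fixes every
  -- vector of the eigenspace.
  have hg : cfc (fun x : ℝ => (x - s)⁻¹) S * (S - (s : ℂ) • 1) = 1 - P := by
    have h1 : S - (s : ℂ) • 1 = cfc (fun x : ℝ => x - s) S := by
      rw [cfc_sub _ _ S (continuousOn_spectrum _ _) (continuousOn_spectrum _ _), cfc_id' ℝ S,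
        cfc_const s S, Algebra.algebraMap_eq_smul_one, Complex.coe_smul]
    rw [h1, hP, ← cfc_one ℝ S, ← cfc_sub _ _ S (continuousOn_spectrum _ _) (continuousOn_spectrum _ _),
      ← cfc_mul _ _ S (continuousOn_spectrum _ _) (continuousOn_spectrum _ _)]
    refine cfc_congr fun x _ => ?_
    by_cases h : x = s
    · simp [h]
    · simp [h, inv_mul_cancel₀ (sub_ne_zero.2 h)]
  have hsa : star P = P := cfc_predicate (R := ℝ) (p := IsSelfAdjoint) _ S
  ext u
  refine Submodule.eq_starProjection_of_mem_of_inner_eq_zero ?_ fun w hw => ?_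
  · rw [Module.End.mem_eigenspace_iff]
    exact DFunLike.congr_fun hSP u
  · have hw' : S w = (s : ℂ) • w := Module.End.mem_eigenspace_iff.1 hw
    have hPw : P w = w := by
      have h2 := DFunLike.congr_fun hg w
      have h3 : (S - (s : ℂ) • 1) w = 0 := by
        change S w - (s : ℂ) • w = 0
        rw [hw', sub_self]
      rw [mul_apply_eq_comp, h3, map_zero] at h2
      exact (sub_eq_zero.1 h2.symm).symm
    rw [← hPw, ← ContinuousLinearMap.adjoint_inner_left, ← ContinuousLinearMap.star_eq_adjoint, hsa,
      map_sub, ← mul_apply_eq_comp P P, hPP, sub_self, inner_zero_left]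

theorem specProj_nonneg {S : ℋ →L[ℂ] ℋ} (hS : IsSelfAdjoint S) (s : ℝ) : 0 ≤ specProj S s := by
  rw [specProj_eq_cfc hS]
  exact cfc_nonneg fun x _ => by split_ifs <;> simp

theorem star_specProj {S : ℋ →L[ℂ] ℋ} (hS : IsSelfAdjoint S) (s : ℝ) : star (specProj S s) = specProj S s :=
  (IsSelfAdjoint.of_nonneg (specProj_nonneg hS s)).star_eq

theorem specProj_mul_self {S : ℋ →L[ℂ] ℋ} (hS : IsSelfAdjoint S) (s : ℝ) : specProj S s * specProj S s = specProj S s := by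
  rw [specProj_eq_cfc hS,
    ← cfc_mul _ _ S (continuousOn_spectrum _ _) (continuousOn_spectrum _ _)]
  refine cfc_congr fun x _ => ?_
  by_cases h : x = s <;> simp [h]

theorem sum_smul_specProj {S : ℋ →L[ℂ] ℋ} (hS : IsSelfAdjoint S) : ∑ s ∈ spec S, (s : ℂ) • specProj S s = S := by
  conv_rhs => rw [← cfc_id ℝ S]
  have h : ∀ s ∈ spec S, (s : ℂ) • specProj S s =
      cfc (fun x : ℝ => s • (if x = s then (1 : ℝ) else 0)) S := fun s _ => by
    rw [specProj_eq_cfc hS, Complex.coe_smul, ← cfc_smul s _ S (continuousOn_spectrum _ _)]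
  rw [Finset.sum_congr rfl h, ← cfc_sum _ S _ fun _ _ => continuousOn_spectrum _ _]
  refine cfc_congr fun x hx => ?_
  simp [Finset.sum_apply, mem_spec.2 hx]

theorem sum_specProj {S : ℋ →L[ℂ] ℋ} (hS : IsSelfAdjoint S) :
    ∑ s ∈ spec S, specProj S s = 1 := by
  rw [← cfc_one ℝ S, Finset.sum_congr rfl fun s _ => specProj_eq_cfc hS s,
    ← cfc_sum _ S _ fun _ _ => continuousOn_spectrum _ _]
  refine cfc_congr fun x hx => ?_
  simp [Finset.sum_apply, mem_spec.2 hx]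

theorem commute_specProj {S : ℋ →L[ℂ] ℋ} (hS : IsSelfAdjoint S) {X : ℋ →L[ℂ] ℋ}
    (h : Commute S X) (s : ℝ) : Commute (specProj S s) X := by
  rw [specProj_eq_cfc hS]
  exact h.cfc_real _

end SpectralProjections

/-! ### Algebraic consequences of detailed balance. -/

section DetailedBalance

variable {ℋ : Type*} [NormedAddCommGroup ℋ] [InnerProductSpace ℂ ℋ] [CompleteSpace ℋ]
  [FiniteDimensional ℂ ℋ] {κ : Type*} [Fintype κ] {L : Lindbladian ℋ κ} {ρ : ℋ →L[ℂ] ℋ}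

theorem ext_tr {A B : ℋ →L[ℂ] ℋ} (h : ∀ C, tr (C * A) = tr (C * B)) : A = B := by
  rw [← sub_eq_zero]
  refine eq_zero_of_bracket fun C => ?_
  rw [bracket, mul_sub, Lindbladian.tr_sub, h, sub_self]

theorem IsState.isSelfAdjoint (h : IsState ρ) : IsSelfAdjoint ρ := h.pos.isSelfAdjoint

theorem IsState.nonneg (h : IsState ρ) : 0 ≤ ρ :=
  (ContinuousLinearMap.nonneg_iff_isPositive _).2 h.pos

namespace Lindbladian

theorem tr_jump_mul (L : Lindbladian ℋ κ) (A B : ℋ →L[ℂ] ℋ) :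
    tr (L.jump A * B) = tr (A * L.Phi B) := by
  simp only [jump_apply, Phi_apply, Finset.sum_mul, Finset.mul_sum, tr_sum]
  refine Finset.sum_congr rfl fun l _ => ?_
  rw [mul_assoc, mul_assoc, tr_mul_comm]
  simp only [mul_assoc]

namespace DetailedBalance

/-- Self-adjointness of `Φ` is used twice, for the pairs `(C*, X)` and `(X*, C)`. Since `Φ` respects
adjoints and `X` commutes with `ρ`, cyclicity identifies `tr(C ρ Φ(X))` with `tr(C Φ(X) ρ)` for
every `C`. -/
theorem commute_Phi (h : L.DetailedBalance ρ) {X : ℋ →L[ℂ] ℋ} (hX : Commute ρ X) :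
    Commute ρ (L.Phi X) := by
  refine ext_tr fun C => ?_
  have h1 := h.selfAdjoint_Phi (star C) X
  have h2 := h.selfAdjoint_Phi (star X) C
  rw [star_Phi, star_star] at h1 h2
  calc tr (C * (ρ * L.Phi X)) = tr (ρ * L.Phi X * C) := tr_mul_comm _ _
    _ = tr (ρ * X * L.Phi C) := h2.symm
    _ = tr (X * (ρ * L.Phi C)) := by rw [hX.eq, mul_assoc]
    _ = tr (ρ * L.Phi C * X) := tr_mul_comm _ _
    _ = tr (ρ * (C * L.Phi X)) := by rw [← h1, mul_assoc]
    _ = tr (C * L.Phi X * ρ) := tr_mul_comm _ _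
    _ = tr (C * (L.Phi X * ρ)) := by rw [mul_assoc]

theorem commute_Phi_one (h : L.DetailedBalance ρ) : Commute ρ (L.Phi 1) :=
  h.commute_Phi (Commute.one_right ρ)

/-- The jump map is the trace dual of `Φ`; detailed balance with `A = 1` moves `Φ` from the test
operator onto `1`. -/
theorem jump_eq (h : L.DetailedBalance ρ) : L.jump ρ = ρ * L.Phi 1 := by
  refine ext_tr fun C => ?_
  have h1 := h.selfAdjoint_Phi 1 C
  rw [star_Phi, star_one, mul_one] at h1
  rw [tr_mul_comm, tr_jump_mul, h1, tr_mul_comm]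

/-- In `L(ρ) = 0` the jump term cancels the anticommutator with `Φ(1)`, so only the Hamiltonian
commutator remains. -/
theorem commute_H (h : L.DetailedBalance ρ) : Commute ρ L.H := by
  have h1 := h.steady
  have e : L.gen ρ = (-Complex.I) • (L.H * ρ - ρ * L.H) + L.jump ρ
    - (1 / 2 : ℂ) • (L.Phi 1 * ρ + ρ * L.Phi 1) := rfl
  rw [e, h.jump_eq, h.commute_Phi_one.eq, ← two_smul ℂ, smul_smul] at h1
  norm_num [sub_eq_zero] at h1
  exact h1.symm

theorem commute_dualGen (h : L.DetailedBalance ρ) {X : ℋ →L[ℂ] ℋ} (hX : Commute ρ X) :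
    Commute ρ (L.dualGen X) := by
  rw [dualGen_apply]
  have h1 := h.commute_H
  have h2 := h.commute_Phi_one
  exact ((((h1.mul_right hX).sub_right (hX.mul_right h1)).smul_right _).sub_right
    (((h2.mul_right hX).add_right (hX.mul_right h2)).smul_right _)).add_right (h.commute_Phi hX)

theorem commute_dualEvol (h : L.DetailedBalance ρ) {X : ℋ →L[ℂ] ℋ} (hX : Commute ρ X) (t : ℝ) :
    Commute ρ (L.dualEvol t X) := by
  let W : Submodule ℂ (ℋ →L[ℂ] ℋ) :=
    { carrier := {X | Commute ρ X}
      add_mem' := fun ha hb => Commute.add_right ha hb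
      zero_mem' := Commute.zero_right ρ
      smul_mem' := fun c X hX => Commute.smul_right hX c }
  refine exp_apply_mem ((t : ℂ) • L.dualGen) W (fun X hX => ?_) hX
  exact W.smul_mem _ (h.commute_dualGen hX)

/-- The first measurement does not affect the later expectations of observables that commute
with the steady state. -/
theorem sum_bracket_evol (h : L.DetailedBalance ρ) {S : ℋ →L[ℂ] ℋ} (hS : IsSelfAdjoint S)
    (hc : ∀ X, Commute ρ X → Commute S X) (ρ₀ : ℋ →L[ℂ] ℋ) {B : ℋ →L[ℂ] ℋ} (hB : Commute ρ B)
    (t : ℝ) :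
    ∑ s ∈ spec S, bracket (L.evol t (specProj S s * ρ₀ * specProj S s)) B =
      bracket (L.evol t ρ₀) B := by
  have hD := hc _ (h.commute_dualEvol hB t)
  have h1 : ∀ s ∈ spec S, bracket (L.evol t (specProj S s * ρ₀ * specProj S s)) B =
      bracketCLM ρ₀ (specProj S s * L.dualEvol t B) := fun s _ => by
    -- In the Heisenberg picture the measurement acts on `D = e^{tL†}(B)`, and `P_s D P_s = P_s D`
    -- because `D` commutes with `P_s`.
    rw [bracket_evol, bracketCLM_apply, bracket, bracket, star_mul, star_mul, star_specProj hS,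
      mul_assoc, tr_mul_comm, mul_assoc, mul_assoc, ← (commute_specProj hS hD s).eq,
      ← mul_assoc (specProj S s), specProj_mul_self hS]
  rw [Finset.sum_congr rfl h1, ← map_sum, ← Finset.sum_mul, sum_specProj hS, one_mul,
    bracketCLM_apply, bracket_evol]

end DetailedBalance

end Lindbladian

end DetailedBalance

/-! ### The law and the mean of the two-time measurement. -/

section TwoTimeMeasurement

variable {ℋ : Type*} [NormedAddCommGroup ℋ] [InnerProductSpace ℂ ℋ] [CompleteSpace ℋ]
  [FiniteDimensional ℂ ℋ] {κ : Type*} [Fintype κ] (L : Lindbladian ℋ κ) {S ρ₀ : ℋ →L[ℂ] ℋ}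

theorem evol_measured_nonneg (hS : IsSelfAdjoint S) (hρ₀ : IsState ρ₀) {t : ℝ} (ht : 0 ≤ t)
    (s : ℝ) : 0 ≤ L.evol t (specProj S s * ρ₀ * specProj S s) := by
  have := hρ₀.nontrivial
  refine L.evol_nonneg ?_ ht
  have h := star_right_conjugate_nonneg hρ₀.nonneg (specProj S s)
  rwa [star_specProj hS] at h

theorem jointProb_nonneg (hS : IsSelfAdjoint S) (hρ₀ : IsState ρ₀) {t : ℝ} (ht : 0 ≤ t)
    (s s' : ℝ) : 0 ≤ jointProb L S ρ₀ t s s' :=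
  bracket_nonneg (evol_measured_nonneg L hS hρ₀ ht s) (specProj_nonneg hS s')

theorem ofReal_jointProb (hS : IsSelfAdjoint S) (hρ₀ : IsState ρ₀) {t : ℝ} (ht : 0 ≤ t)
    (s s' : ℝ) : (jointProb L S ρ₀ t s s' : ℂ) =
      bracket (L.evol t (specProj S s * ρ₀ * specProj S s)) (specProj S s') :=
  bracket_self_star (.of_nonneg (evol_measured_nonneg L hS hρ₀ ht s))
    (.of_nonneg (specProj_nonneg hS s'))

theorem sum_bracket_specProj (hS : IsSelfAdjoint S) (A : ℋ →L[ℂ] ℋ) :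
    ∑ s ∈ spec S, bracket A (specProj S s) = bracket A 1 := by
  simp only [← bracketCLM_apply]
  rw [← map_sum, sum_specProj hS]

theorem sum_mul_bracket_specProj (hS : IsSelfAdjoint S) (A : ℋ →L[ℂ] ℋ) :
    ∑ s ∈ spec S, (s : ℂ) * bracket A (specProj S s) = bracket A S := by
  simp only [← bracketCLM_apply]
  conv_rhs => rw [← sum_smul_specProj hS, map_sum]
  simp

/-- The law of the first outcome is the law of `S` in the initial state. -/
theorem bracket_evol_measured_one (hS : IsSelfAdjoint S) (ρ₀ : ℋ →L[ℂ] ℋ) (t s : ℝ) :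
    bracket (L.evol t (specProj S s * ρ₀ * specProj S s)) 1 = bracket ρ₀ (specProj S s) := by
  rw [bracket, mul_one, tr_star, L.tr_evol, ← tr_star, bracket, star_mul, star_mul,
    star_specProj hS, Lindbladian.tr_mul_comm, mul_assoc, specProj_mul_self hS]

theorem sum_jointProb (hS : IsSelfAdjoint S) (hρ₀ : IsState ρ₀) {t : ℝ} (ht : 0 ≤ t) :
    ∑ s ∈ spec S, ∑ s' ∈ spec S, jointProb L S ρ₀ t s s' = 1 := by
  have h : ((∑ s ∈ spec S, ∑ s' ∈ spec S, jointProb L S ρ₀ t s s' : ℝ) : ℂ) = 1 := by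
    push_cast
    simp only [ofReal_jointProb L hS hρ₀ ht, sum_bracket_specProj hS,
      bracket_evol_measured_one L hS]
    rw [bracket, mul_one, tr_star, hρ₀.trace_one, star_one]
  exact_mod_cast h

theorem isProbabilityMeasure_twoTimeLaw (hS : IsSelfAdjoint S) (hρ₀ : IsState ρ₀) {t : ℝ}
    (ht : 0 ≤ t) : IsProbabilityMeasure (twoTimeLaw L S ρ₀ t) := by
  refine ⟨?_⟩
  simp only [twoTimeLaw, Measure.coe_finsetSum, Finset.sum_apply, Measure.smul_apply,
    measure_univ, smul_eq_mul, mul_one]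
  rw [← ENNReal.ofReal_one, ← sum_jointProb L hS hρ₀ ht,
    ENNReal.ofReal_sum_of_nonneg fun s _ =>
      Finset.sum_nonneg fun s' _ => jointProb_nonneg L hS hρ₀ ht s s']
  refine Finset.sum_congr rfl fun s _ => ?_
  rw [ENNReal.ofReal_sum_of_nonneg fun s' _ => jointProb_nonneg L hS hρ₀ ht s s']

theorem twoTimeExpectation_eq_sum (hS : IsSelfAdjoint S) (hρ₀ : IsState ρ₀) {t : ℝ}
    (ht : 0 ≤ t) : twoTimeExpectation L S ρ₀ t =
      ∑ s ∈ spec S, ∑ s' ∈ spec S, (s' - s) * jointProb L S ρ₀ t s s' := by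
  have hint : ∀ s s', Integrable (fun σ : ℝ => σ)
      (ENNReal.ofReal (jointProb L S ρ₀ t s s') • Measure.dirac (s' - s)) := fun s s' =>
    (integrable_dirac (by simp)).smul_measure ENNReal.ofReal_ne_top
  rw [twoTimeExpectation, twoTimeLaw, integral_finsetSum_measure fun s _ =>
    integrable_finsetSum_measure.2 fun s' _ => hint s s']
  refine Finset.sum_congr rfl fun s _ => ?_
  rw [integral_finsetSum_measure fun s' _ => hint s s']
  refine Finset.sum_congr rfl fun s' _ => ?_
  rw [integral_smul_measure, integral_dirac,
    ENNReal.toReal_ofReal (jointProb_nonneg L hS hρ₀ ht s s'), smul_eq_mul, mul_comm]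

theorem twoTimeExpectation_eq {ρ : ℋ →L[ℂ] ℋ} (h : L.DetailedBalance ρ) (hS : IsSelfAdjoint S)
    (hc : ∀ X, Commute ρ X → Commute S X) (hρS : Commute ρ S) (hρ₀ : IsState ρ₀) {t : ℝ}
    (ht : 0 ≤ t) :
    (twoTimeExpectation L S ρ₀ t : ℂ) = bracket (L.evol t ρ₀) S - bracket ρ₀ S := by
  rw [twoTimeExpectation_eq_sum L hS hρ₀ ht]
  push_cast
  simp only [ofReal_jointProb L hS hρ₀ ht, sub_mul, Finset.sum_sub_distrib, ← Finset.mul_sum,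
    sum_bracket_specProj hS, sum_mul_bracket_specProj hS, bracket_evol_measured_one L hS,
    h.sum_bracket_evol hS hc ρ₀ hρS]

end TwoTimeMeasurement

/-! ### Affine and quadratic bounds for `-x log x` and its operator version. -/

section QuadraticBounds

/-- The right side is the tangent line at `r` of a concave function; it follows from `log y ≤ y - 1`
at `y = r / x`. -/
theorem negMulLog_le {x r : ℝ} (hx : 0 ≤ x) (hr : 0 < r) :
    Real.negMulLog x ≤ r + (-Real.log r - 1) * x := by
  rcases hx.eq_or_lt with rfl | hx
  · simp [hr.le]
  · have h1 := Real.log_le_sub_one_of_pos (div_pos hr hx)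
    rw [Real.log_div hr.ne' hx.ne'] at h1
    have h2 : x * (r / x) = r := by field_simp
    rw [Real.negMulLog]
    nlinarith

/-- From `log y ≤ y - 1` at `y = x / p`. The parabola touches `-x log x` at `p` with the same slope,
so together with the tangent line it determines first derivatives there. -/
theorem le_negMulLog {x p : ℝ} (hx : 0 ≤ x) (hp : 0 < p) :
    (1 - Real.log p) * x - x ^ 2 / p ≤ Real.negMulLog x := by
  rcases hx.eq_or_lt with rfl | hx
  · simp
  · have h1 := Real.log_le_sub_one_of_pos (div_pos hx hp)
    rw [Real.log_div hx.ne' hp.ne'] at h1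
    have h2 : x ^ 2 / p = x * (x / p) := by ring
    rw [Real.negMulLog, h2]
    nlinarith

variable {ℋ : Type*} [NormedAddCommGroup ℋ] [InnerProductSpace ℂ ℋ] [CompleteSpace ℋ]

/-- The (real part of the) expectation of `A` in the vector `e`. -/
noncomputable def expect (e : ℋ) (A : ℋ →L[ℂ] ℋ) : ℝ := (inner ℂ e (A e)).re

theorem expect_add (e : ℋ) (A B : ℋ →L[ℂ] ℋ) : expect e (A + B) = expect e A + expect e B := by
  simp [expect]

theorem expect_sub (e : ℋ) (A B : ℋ →L[ℂ] ℋ) : expect e (A - B) = expect e A - expect e B := by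
  simp [expect]

theorem expect_mono (e : ℋ) {A B : ℋ →L[ℂ] ℋ} (h : A ≤ B) : expect e A ≤ expect e B := by
  rw [← sub_nonneg, ← expect_sub]
  exact ((ContinuousLinearMap.le_def _ _).1 h).re_inner_nonneg_right e

theorem expect_nonneg (e : ℋ) {A : ℋ →L[ℂ] ℋ} (h : 0 ≤ A) : 0 ≤ expect e A :=
  ((ContinuousLinearMap.nonneg_iff_isPositive _).1 h).re_inner_nonneg_right e

theorem abs_expect_le {e : ℋ} (he : ‖e‖ = 1) (A : ℋ →L[ℂ] ℋ) : |expect e A| ≤ ‖A‖ := by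
  refine (Complex.abs_re_le_norm _).trans ((norm_inner_le_norm _ _).trans ?_)
  simpa [he] using A.le_opNorm e

/-- `expect` as a continuous functional. -/
noncomputable def expectCLM (e : ℋ) : (ℋ →L[ℂ] ℋ) →L[ℝ] ℝ :=
  Complex.reCLM.comp (((innerSL ℂ e).comp (ContinuousLinearMap.apply ℂ ℋ e)).restrictScalars ℝ)

theorem expectCLM_apply (e : ℋ) (A : ℋ →L[ℂ] ℋ) : expectCLM e A = expect e A := rfl

theorem expect_of_apply_eq {e : ℋ} (he : ‖e‖ = 1) {A : ℋ →L[ℂ] ℋ} {p : ℝ}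
    (h : A e = (p : ℂ) • e) : expect e A = p := by
  rw [expect, h, inner_smul_right, inner_self_eq_norm_sq_to_K, he]
  simp

variable [FiniteDimensional ℂ ℋ]

/-- Expectations of quadratic functions of `A` involve only `⟨e|A e⟩` and `‖A e‖`. Scalar bounds on
the spectrum thus become bounds needing no eigenvectors of `A`. -/
theorem expect_quadratic {A : ℋ →L[ℂ] ℋ} (hA : IsSelfAdjoint A) {e : ℋ} (he : ‖e‖ = 1)
    (c₀ c₁ c₂ : ℝ) : expect e (cfc (fun x : ℝ => c₀ + c₁ * x + c₂ * x ^ 2) A) =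
      c₀ + c₁ * expect e A + c₂ * ‖A e‖ ^ 2 := by
  have h1 : cfc (fun x : ℝ => c₀ + c₁ * x + c₂ * x ^ 2) A =
      (c₀ : ℂ) • 1 + (c₁ : ℂ) • A + (c₂ : ℂ) • (A * A) := by
    rw [cfc_add A _ _, cfc_add A _ _, cfc_const_mul _ _ A, cfc_const_mul _ _ A, cfc_pow_id A 2,
      cfc_id' ℝ A, cfc_const c₀ A, Algebra.algebraMap_eq_smul_one, Complex.coe_smul,
      Complex.coe_smul, Complex.coe_smul, pow_two]
  have h2 : inner ℂ e (A (A e)) = ((‖A e‖ ^ 2 : ℝ) : ℂ) := by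
    rw [← ContinuousLinearMap.adjoint_inner_left, ← ContinuousLinearMap.star_eq_adjoint,
      hA.star_eq, inner_self_eq_norm_sq_to_K]
    norm_cast
  rw [expect, h1]
  change (inner ℂ e ((c₀ : ℂ) • e + (c₁ : ℂ) • A e + (c₂ : ℂ) • A (A e))).re = _
  rw [inner_add_right, inner_add_right, inner_smul_right, inner_smul_right, inner_smul_right, h2,
    inner_self_eq_norm_sq_to_K, he]
  simp only [expect, Complex.add_re, Complex.re_ofReal_mul,
    Complex.ofReal_re]
  simp

theorem expect_negMulLog_le {A : ℋ →L[ℂ] ℋ} (hA : 0 ≤ A) {e : ℋ} (he : ‖e‖ = 1) {r : ℝ}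
    (hr : 0 < r) :
    expect e (cfc Real.negMulLog A) ≤ r + (-Real.log r - 1) * expect e A := by
  have h := expect_quadratic (.of_nonneg hA) he r (-Real.log r - 1) 0
  rw [zero_mul, add_zero] at h
  rw [← h]
  refine expect_mono e (cfc_mono (fun x hx => ?_) (continuousOn_spectrum _ _)
    (continuousOn_spectrum _ _))
  simpa using negMulLog_le (spectrum_nonneg_of_nonneg hA hx) hr

theorem le_expect_negMulLog {A : ℋ →L[ℂ] ℋ} (hA : 0 ≤ A) {e : ℋ} (he : ‖e‖ = 1) {p : ℝ}
    (hp : 0 < p) :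
    (1 - Real.log p) * expect e A - ‖A e‖ ^ 2 / p ≤ expect e (cfc Real.negMulLog A) := by
  have h := expect_quadratic (.of_nonneg hA) he 0 (1 - Real.log p) (-p⁻¹)
  have h2 : (1 - Real.log p) * expect e A - ‖A e‖ ^ 2 / p =
      0 + (1 - Real.log p) * expect e A + -p⁻¹ * ‖A e‖ ^ 2 := by ring
  rw [h2, ← h]
  refine expect_mono e (cfc_mono (fun x hx => ?_) (continuousOn_spectrum _ _)
    (continuousOn_spectrum _ _))
  refine (le_of_eq ?_).trans (le_negMulLog (spectrum_nonneg_of_nonneg hA hx) hp)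
  ring

/-- The lower bound `le_expect_negMulLog`, expanded at an approximate eigenvalue `p`. -/
theorem le_expect_negMulLog' {A : ℋ →L[ℂ] ℋ} (hA : 0 ≤ A) {e : ℋ} (he : ‖e‖ = 1) {p : ℝ}
    (hp : 0 < p) :
    Real.negMulLog p - (Real.log p + 1) * (expect e A - p) - ‖A e - (p : ℂ) • e‖ ^ 2 / p ≤
      expect e (cfc Real.negMulLog A) := by
  refine (le_of_eq ?_).trans (le_expect_negMulLog hA he hp)
  have h1 : ‖A e - (p : ℂ) • e‖ ^ 2 = ‖A e‖ ^ 2 - 2 * (p * expect e A) + p ^ 2 := by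
    have hsym : inner ℂ (A e) e = inner ℂ e (A e) := by
      rw [← ContinuousLinearMap.adjoint_inner_right, ← ContinuousLinearMap.star_eq_adjoint,
        (IsSelfAdjoint.of_nonneg hA).star_eq]
    rw [norm_sub_sq (𝕜 := ℂ), inner_smul_right, hsym, norm_smul, he]
    simp [expect]
  rw [h1, Real.negMulLog]
  field_simp
  ring

theorem expect_negMulLog_of_apply_eq {A : ℋ →L[ℂ] ℋ} (hA : 0 ≤ A) {e : ℋ} (he : ‖e‖ = 1) {p : ℝ}
    (hp : 0 ≤ p) (h : A e = (p : ℂ) • e) : expect e (cfc Real.negMulLog A) = Real.negMulLog p := by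
  have ha := expect_of_apply_eq he h
  rcases hp.eq_or_lt with rfl | hp
  · have h0 : ‖A e‖ = 0 := by simp [h]
    refine le_antisymm ?_ ?_
    -- No tangent line exists at `0`; the tangents at `r > 0` are used and `r` tends to `0`.
    · refine le_of_forall_pos_le_add fun r hr => ?_
      simpa [ha] using expect_negMulLog_le hA he hr
    · simpa [ha, h0] using le_expect_negMulLog hA he one_pos
  · refine le_antisymm ?_ ?_
    · refine (expect_negMulLog_le hA he hp).trans_eq ?_
      rw [ha, Real.negMulLog]; ring
    · refine (le_of_eq ?_).trans (le_expect_negMulLog' hA he hp)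
      simp [ha, h]

theorem vnEntropy_eq_sum {ι : Type*} [Fintype ι] (b : OrthonormalBasis ι ℂ ℋ) {ρ : ℋ →L[ℂ] ℋ}
    (hρ : IsSelfAdjoint ρ) : vnEntropy ρ = ∑ i, expect (b i) (cfc Real.negMulLog ρ) := by
  have h1 : cfc Real.negMulLog ρ = -(ρ * CFC.log ρ) := by
    have h2 : ρ * CFC.log ρ = cfc (fun x : ℝ => x * Real.log x) ρ := by
      rw [cfc_mul _ _ ρ (continuousOn_spectrum _ _) (continuousOn_spectrum _ _), cfc_id' ℝ ρ,
        CFC.log]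
    rw [h2, ← cfc_neg]
    exact cfc_congr fun x _ => by simp [Real.negMulLog]
  rw [vnEntropy, bracket, hρ.star_eq, ← Complex.neg_re, ← trCLM_apply, ← map_neg, ← h1,
    trCLM_apply, tr_eq_sum_inner b, Complex.re_sum]
  rfl

end QuadraticBounds

/-! ### Right slopes of the diagonal entropy terms. -/

section SlopeOfEntropy

variable {ℋ : Type*} [NormedAddCommGroup ℋ] [InnerProductSpace ℂ ℋ] [CompleteSpace ℋ]
  [FiniteDimensional ℂ ℋ] {κ : Type*} [Fintype κ] (L : Lindbladian ℋ κ) {ρ : ℋ →L[ℂ] ℋ}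
  {e : ℋ} {p : ℝ}

theorem tendsto_slope_expect (e : ℋ) (ρ : ℋ →L[ℂ] ℋ) :
    Tendsto (fun h => (expect e (L.evol h ρ) - expect e ρ) / h) (𝓝[>] 0)
      (𝓝 (expect e (L.gen ρ))) := by
  have h1 := (expectCLM e).hasFDerivAt.comp_hasDerivAt 0 (L.hasDerivAt_evol ρ 0)
  have h2 := (hasDerivAt_iff_tendsto_slope.1 h1).mono_left
    (nhdsWithin_mono 0 fun x (hx : 0 < x) => hx.ne')
  rw [L.evol_zero] at h2
  refine h2.congr fun h => ?_
  simp [slope_def_field, expectCLM_apply, L.evol_zero]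

theorem tendsto_norm_sq_div (e : ℋ) (ρ : ℋ →L[ℂ] ℋ) :
    Tendsto (fun h => ‖L.evol h ρ e - ρ e‖ ^ 2 / h) (𝓝[>] 0) (𝓝 0) := by
  have h1 := ((ContinuousLinearMap.apply ℂ ℋ e).restrictScalars ℝ).hasFDerivAt.comp_hasDerivAt 0
    (L.hasDerivAt_evol ρ 0)
  have h2 := ((hasDerivAt_iff_tendsto_slope.1 h1).mono_left
    (nhdsWithin_mono 0 fun x (hx : 0 < x) => hx.ne')).norm
  have h3 := ((h1.continuousAt.tendsto.mono_left
    (nhdsWithin_le_nhds (s := Set.Ioi 0))).sub_const (ρ e)).norm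
  have h4 := h2.mul h3
  simp only [Function.comp_def, ContinuousLinearMap.coe_restrictScalars',
    ContinuousLinearMap.apply_apply, L.evol_zero, sub_self, norm_zero, mul_zero] at h4
  refine h4.congr' ?_
  filter_upwards [self_mem_nhdsWithin] with h hh
  have hh' : (0 : ℝ) < h := hh
  rw [slope_def_module, norm_smul, sub_zero, L.evol_zero, norm_inv, Real.norm_of_nonneg hh'.le]
  field_simp

/-- The two bounds at `p` differ by `‖A e - p e‖² / p`, which is `O(h²)`, so their slopes have a
common limit. -/
theorem tendsto_slope_expect_negMulLog_of_pos (hρ : IsState ρ) (he : ‖e‖ = 1) (hp : 0 < p)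
    (hpe : ρ e = (p : ℂ) • e) :
    Tendsto (fun h => (expect e (cfc Real.negMulLog (L.evol h ρ)) -
      expect e (cfc Real.negMulLog ρ)) / h) (𝓝[>] 0)
      (𝓝 (-(Real.log p + 1) * expect e (L.gen ρ))) := by
  have ha := expect_of_apply_eq he hpe
  have h1 := (tendsto_slope_expect L e ρ).const_mul (-(Real.log p + 1))
  have h2 := h1.sub ((tendsto_norm_sq_div L e ρ).div_const p)
  rw [zero_div, sub_zero] at h2
  rw [expect_negMulLog_of_apply_eq hρ.nonneg he hp.le hpe]
  refine tendsto_of_tendsto_of_tendsto_of_le_of_le' h2 h1 ?_ ?_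
  all_goals
    filter_upwards [self_mem_nhdsWithin] with h hh
    have hh' : (0 : ℝ) < h := hh
    have hA := (hρ.evol L hh'.le).nonneg
  · have h3 := le_expect_negMulLog' hA he hp
    rw [← hpe] at h3
    rw [ha, le_div_iff₀ hh']
    refine (le_of_eq ?_).trans (sub_le_sub_right h3 _)
    field_simp
    ring
  · have h3 := expect_negMulLog_le hA he hp
    rw [ha, div_le_iff₀ hh']
    refine (sub_le_sub_right h3 _).trans_eq ?_
    rw [Real.negMulLog]
    field_simp
    ring

theorem tendsto_slope_expect_negMulLog_of_ker (hρ : IsState ρ) (he : ‖e‖ = 1)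
    (hpe : ρ e = 0) (hL : expect e (L.gen ρ) = 0) :
    Tendsto (fun h => (expect e (cfc Real.negMulLog (L.evol h ρ)) -
      expect e (cfc Real.negMulLog ρ)) / h) (𝓝[>] 0) (𝓝 0) := by
  have := hρ.nontrivial
  have hpe' : ρ e = ((0 : ℝ) : ℂ) • e := by simp [hpe]
  have ha := expect_of_apply_eq he hpe'
  rw [expect_negMulLog_of_apply_eq hρ.nonneg he le_rfl hpe', Real.negMulLog_zero]
  have hO : (fun h : ℝ => expect e (L.evol h ρ)) =O[𝓝 0] fun h => h ^ 2 := by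
    have h1 := (expectCLM e).isBigO_comp (fun h : ℝ => L.evol h ρ - (ρ + (h : ℂ) • L.gen ρ)) (𝓝 0)
    refine (h1.trans (exp_smul_apply_isBigO L.gen ρ)).congr_left fun h => ?_
    rw [Complex.coe_smul, map_sub, map_add, map_smul, expectCLM_apply, expectCLM_apply,
      expectCLM_apply, hL, ha]
    simp
  obtain ⟨C, hC⟩ := hO.bound
  have hlow := (tendsto_norm_sq_div L e ρ).neg
  simp only [hpe, sub_zero, neg_zero] at hlow
  have hup : Tendsto (fun h : ℝ => 2 * C * Real.negMulLog h + h) (𝓝[>] 0) (𝓝 0) := by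
    have : Continuous fun h : ℝ => 2 * C * Real.negMulLog h + h := by fun_prop
    simpa using (this.tendsto 0).mono_left nhdsWithin_le_nhds
  refine tendsto_of_tendsto_of_tendsto_of_le_of_le' hlow hup ?_ ?_
  · filter_upwards [self_mem_nhdsWithin] with h hh
    have hh' : (0 : ℝ) < h := hh
    have hA := (hρ.evol L hh'.le).nonneg
    have h3 := le_expect_negMulLog hA he one_pos
    have h4 := expect_nonneg e hA
    rw [sub_zero, ← neg_div]
    gcongr
    simp at h3
    linarith
  · filter_upwards [self_mem_nhdsWithin, nhdsWithin_le_nhds hC, Ioo_mem_nhdsGT one_pos]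
      with h hh hCh hI
    have hh' : (0 : ℝ) < h := hh
    have hA := (hρ.evol L hh'.le).nonneg
    -- The tangent point `r = h²` matches the size of the expectation: the bound becomes `O(h² |log
    -- h|)`, which is `o(h)`.
    have h3 := expect_negMulLog_le hA he (pow_pos hh' 2)
    have h4 := expect_nonneg e hA
    have h5 : expect e (L.evol h ρ) ≤ C * h ^ 2 := by
      have := (le_abs_self _).trans hCh
      rwa [Real.norm_of_nonneg (by positivity)] at this
    have hlog : Real.log h ≤ 0 := Real.log_nonpos hh'.le hI.2.le
    rw [sub_zero, div_le_iff₀ hh']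
    rw [Real.log_pow] at h3
    rw [Real.negMulLog]
    push_cast at h3
    nlinarith [mul_nonneg (neg_nonneg.2 hlog) (sub_nonneg.2 h5)]

theorem tendsto_slope_expect_negMulLog_atTop (hρ : IsState ρ) (he : ‖e‖ = 1)
    (hpe : ρ e = 0) (hL : 0 < expect e (L.gen ρ)) :
    Tendsto (fun h => (expect e (cfc Real.negMulLog (L.evol h ρ)) -
      expect e (cfc Real.negMulLog ρ)) / h) (𝓝[>] 0) atTop := by
  have hpe' : ρ e = ((0 : ℝ) : ℂ) • e := by simp [hpe]
  have ha := expect_of_apply_eq he hpe'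
  rw [expect_negMulLog_of_apply_eq hρ.nonneg he le_rfl hpe', Real.negMulLog_zero]
  refine tendsto_atTop.2 fun M => ?_
  set a := expect e (L.gen ρ)
  -- Here `p` is a free parameter of the lower bound, not an eigenvalue. The limiting slope is `(1 -
  -- log p) a`, and `p = exp(-M/a)` makes it `a + M > M`.
  have h1 := (tendsto_slope_expect L e ρ).const_mul (1 - Real.log (Real.exp (-(M / a))))
  have h2 := h1.sub ((tendsto_norm_sq_div L e ρ).div_const (Real.exp (-(M / a))))
  have h3 : M < (1 - Real.log (Real.exp (-(M / a)))) * a - 0 / Real.exp (-(M / a)) := by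
    rw [Real.log_exp, zero_div, sub_zero, sub_neg_eq_add, add_mul, div_mul_cancel₀ _ hL.ne']
    linarith
  filter_upwards [h2.eventually (lt_mem_nhds h3), self_mem_nhdsWithin] with h hM hh
  have hh' : (0 : ℝ) < h := hh
  have hA := (hρ.evol L hh'.le).nonneg
  have h4 := le_expect_negMulLog hA he (Real.exp_pos (-(M / a)))
  refine hM.le.trans ?_
  rw [sub_zero, le_div_iff₀ hh', ha, hpe, sub_zero, sub_zero]
  refine (le_of_eq ?_).trans h4
  field_simp

end SlopeOfEntropy

/-! ### The right derivative of the von Neumann entropy. -/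

section EntropyRate

variable {ℋ : Type*} [NormedAddCommGroup ℋ] [InnerProductSpace ℂ ℋ] [CompleteSpace ℋ]
  [FiniteDimensional ℂ ℋ] {κ : Type*} [Fintype κ] (L : Lindbladian ℋ κ) {ρ : ℋ →L[ℂ] ℋ}

/-- On an eigenvector the two drift terms add up to `p` times the expectation of `G + G* = -Φ(1)`.
The rate is a gain minus a loss, as in a classical master equation. -/
theorem expect_gen_of_apply_eq (hρ : IsState ρ) {e : ℋ} {p : ℝ} (hpe : ρ e = (p : ℂ) • e) :
    expect e (L.gen ρ) = expect e (L.jump ρ) - p * expect e (L.Phi 1) := by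
  have hP : star (L.Phi 1) = L.Phi 1 := by rw [L.star_Phi, star_one]
  have h1 : inner ℂ e (ρ (star L.drift e)) = p * inner ℂ e (star L.drift e) := by
    rw [← ContinuousLinearMap.adjoint_inner_left, ← ContinuousLinearMap.star_eq_adjoint,
      hρ.isSelfAdjoint.star_eq, hpe, inner_smul_left, Complex.conj_ofReal]
  have h2 : L.drift + star L.drift = -L.Phi 1 := by
    rw [L.star_drift, Lindbladian.drift]
    have : L.Phi 1 = (1 / 2 : ℂ) • L.Phi 1 + (1 / 2 : ℂ) • L.Phi 1 := by
      rw [← add_smul]; norm_num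
    conv_rhs => rw [this]
    abel
  have h3 : expect e L.drift + expect e (star L.drift) = -expect e (L.Phi 1) := by
    rw [← expect_add, h2]
    simp [expect]
  have h4 : expect e (L.drift * ρ) = p * expect e L.drift := by
    simp [expect, hpe]
  have h5 : expect e (ρ * star L.drift) = p * expect e (star L.drift) := by
    rw [expect, mul_apply_eq_comp, h1, Complex.re_ofReal_mul, expect]
  rw [L.gen_eq_drift, expect_add, expect_add, h4, h5]
  linear_combination p * h3

theorem expect_gen_of_ker (hρ : IsState ρ) {e : ℋ} (he : ρ e = 0) :
    expect e (L.gen ρ) = expect e (L.jump ρ) := by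
  simpa using expect_gen_of_apply_eq L hρ (p := 0) (by simpa using he)

theorem tr_gen (A : ℋ →L[ℂ] ℋ) : tr (L.gen A) = 0 := by
  have h := L.bracket_gen A 1
  rw [L.dualGen_one, bracket, bracket, mul_one, mul_zero, tr_star] at h
  rw [← star_eq_zero, h]
  simp [tr]

/-- Along the evolution the von Neumann entropy has a right derivative in `(-∞, ∞]`. It is finite
if the kernel of the state carries no instantaneous gain, and then bounded below by a constant. -/
theorem entropy_slope (hρ : IsState ρ) :
    (∃ d, -(Module.finrank ℂ ℋ * ‖L.Phi 1‖) ≤ d ∧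
      Tendsto (fun h => (vnEntropy (L.evol h ρ) - vnEntropy ρ) / h) (𝓝[>] 0) (𝓝 d)) ∨
    ((∃ v, ρ v = 0 ∧ expect v (L.gen ρ) ≠ 0) ∧
      Tendsto (fun h => (vnEntropy (L.evol h ρ) - vnEntropy ρ) / h) (𝓝[>] 0) atTop) := by
  have hsym : (ρ : ℋ →ₗ[ℂ] ℋ).IsSymmetric := hρ.isSelfAdjoint.isSymmetric
  set b := hsym.eigenvectorBasis rfl
  set p := hsym.eigenvalues rfl
  have hb : ∀ i, ‖b i‖ = 1 := fun i => b.norm_eq_one i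
  have hpb : ∀ i, ρ (b i) = (p i : ℂ) • b i := fun i => hsym.apply_eigenvectorBasis rfl i
  have hp : ∀ i, p i = expect (b i) ρ := fun i => (expect_of_apply_eq (hb i) (hpb i)).symm
  have hp0 : ∀ i, 0 ≤ p i := fun i => by rw [hp]; exact expect_nonneg _ hρ.nonneg
  have hsum : ∀ A : ℋ →L[ℂ] ℋ, ∑ i, expect (b i) A = (tr A).re := fun A => by
    rw [tr_eq_sum_inner b, Complex.re_sum]; rfl
  have hp1 : ∀ i, p i ≤ 1 := fun i => by
    have h1 : ∑ i, p i = 1 := by simp only [hp, hsum, hρ.trace_one, Complex.one_re]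
    rw [← h1]
    exact Finset.single_le_sum (fun j _ => hp0 j) (Finset.mem_univ i)
  have hJ : ∀ v, 0 ≤ expect v (L.jump ρ) := fun v => expect_nonneg v (L.jump_nonneg hρ.nonneg)
  set q : Fin (Module.finrank ℂ ℋ) → ℝ → ℝ := fun i h =>
    (expect (b i) (cfc Real.negMulLog (L.evol h ρ)) - expect (b i) (cfc Real.negMulLog ρ)) / h
    with hq
  have hF : (fun h => ∑ i, q i h) =ᶠ[𝓝[>] 0]
      fun h => (vnEntropy (L.evol h ρ) - vnEntropy ρ) / h := by
    filter_upwards [self_mem_nhdsWithin] with h hh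
    rw [vnEntropy_eq_sum b hρ.isSelfAdjoint,
      vnEntropy_eq_sum b (hρ.evol L (le_of_lt hh)).isSelfAdjoint, ← Finset.sum_sub_distrib,
      Finset.sum_div]
  by_cases hk : ∃ i, p i = 0 ∧ expect (b i) (L.gen ρ) ≠ 0
  · right
    obtain ⟨i, hi, hi'⟩ := hk
    have hbi : ρ (b i) = 0 := by rw [hpb, hi]; simp
    refine ⟨⟨b i, hbi, hi'⟩, Tendsto.congr' hF ?_⟩
    have hpos : ∀ j, p j = 0 → 0 ≤ expect (b j) (L.gen ρ) := fun j hj => by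
      rw [expect_gen_of_ker L hρ (by rw [hpb, hj]; simp)]; exact hJ _
    -- No slope tends to `-∞`, so one divergent term decides the sum.
    have hlow : ∀ j, ∃ c, ∀ᶠ h in 𝓝[>] 0, c ≤ q j h := by
      intro j
      rcases (hp0 j).eq_or_lt with h0 | h0
      · have hbj : ρ (b j) = 0 := by rw [hpb, ← h0]; simp
        rcases (hpos j h0.symm).eq_or_lt with h1 | h1
        · exact ⟨-1, (tendsto_slope_expect_negMulLog_of_ker L hρ (hb j) hbj h1.symm).eventually
            (le_mem_nhds (by norm_num))⟩
        · exact ⟨0, (tendsto_slope_expect_negMulLog_atTop L hρ (hb j) hbj h1).eventually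
            (eventually_ge_atTop 0)⟩
      · exact ⟨_, (tendsto_slope_expect_negMulLog_of_pos L hρ (hb j) h0 (hpb j)).eventually
          (le_mem_nhds (sub_one_lt _))⟩
    choose c hc using hlow
    have hrest : ∀ᶠ h in 𝓝[>] (0 : ℝ), ∑ j ∈ Finset.univ.erase i, c j ≤
        ∑ j ∈ Finset.univ.erase i, q j h := by
      filter_upwards [eventually_all.2 hc] with h hh
      exact Finset.sum_le_sum fun j _ => hh j
    have htop := tendsto_slope_expect_negMulLog_atTop L hρ (hb i) hbi
      ((hpos i hi).lt_of_ne' hi')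
    refine (tendsto_atTop_add_right_of_le' _ _ htop hrest).congr fun h => ?_
    exact Finset.add_sum_erase _ (fun j => q j h) (Finset.mem_univ i)
  · left
    push Not at hk
    refine ⟨∑ i, -(Real.log (p i) + 1) * expect (b i) (L.gen ρ), ?_, Tendsto.congr' hF ?_⟩
    · have h1 : ∑ i, expect (b i) (L.gen ρ) = 0 := by rw [hsum, tr_gen, Complex.zero_re]
      -- Trace preservation removes the constant `1`. As `0 ≤ p i ≤ 1`, the gain contributes
      -- nonnegatively, and the loss at least `-‖Φ(1)‖` because `-p log p` lies in `[0, 1]`.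
      have h2 : ∑ i, -(Real.log (p i) + 1) * expect (b i) (L.gen ρ) =
          ∑ i, -Real.log (p i) * expect (b i) (L.gen ρ) := by
        rw [← sub_eq_zero, ← Finset.sum_sub_distrib, ← neg_eq_zero, ← Finset.sum_neg_distrib,
          ← h1]
        exact Finset.sum_congr rfl fun i _ => by ring
      have h3 : -(Module.finrank ℂ ℋ * ‖L.Phi 1‖) =
          ∑ _i : Fin (Module.finrank ℂ ℋ), -‖L.Phi 1‖ := by simp
      rw [h2, h3]
      refine Finset.sum_le_sum fun i _ => ?_
      rw [expect_gen_of_apply_eq L hρ (hpb i)]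
      have h4 : 0 ≤ -Real.log (p i) * expect (b i) (L.jump ρ) :=
        mul_nonneg (neg_nonneg.2 (Real.log_nonpos (hp0 i) (hp1 i))) (hJ _)
      have h5 : Real.negMulLog (p i) ≤ 1 := by
        have := negMulLog_le (hp0 i) one_pos
        simp at this
        linarith [hp0 i]
      have h6 := Real.negMulLog_nonneg (hp0 i) (hp1 i)
      have h7 := (abs_le.1 (abs_expect_le (hb i) (L.Phi 1))).2
      have h8 : Real.negMulLog (p i) * expect (b i) (L.Phi 1) ≤ 1 * ‖L.Phi 1‖ :=
        (mul_le_mul_of_nonneg_left h7 h6).trans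
          (mul_le_mul_of_nonneg_right h5 (norm_nonneg _))
      rw [Real.negMulLog] at h8
      nlinarith
    · refine tendsto_finsetSum _ fun i _ => ?_
      rcases (hp0 i).eq_or_lt with h0 | h0
      -- The junk value `log 0 = 0` is harmless: its factor vanishes.
      · rw [hk i h0.symm, mul_zero]
        exact tendsto_slope_expect_negMulLog_of_ker L hρ (hb i) (by rw [hpb, ← h0]; simp)
          (hk i h0.symm)
      · exact tendsto_slope_expect_negMulLog_of_pos L hρ (hb i) h0 (hpb i)

end EntropyRate

/-! ### Entropy production and entropy balance along a trajectory. -/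

section EntropyAlongTrajectory

variable {ℋ : Type*} [NormedAddCommGroup ℋ] [InnerProductSpace ℂ ℋ] [CompleteSpace ℋ]
  [FiniteDimensional ℂ ℋ] {κ : Type*} [Fintype κ] (L : Lindbladian ℋ κ) {ρ : ℋ →L[ℂ] ℋ}

/-- At positive times there is no instantaneous gain in the kernel of the state. -/
theorem expect_gen_evol_of_ker (hρ : IsState ρ) {s : ℝ} (hs : 0 < s) {v : ℋ}
    (hv : L.evol s ρ v = 0) : expect v (L.gen (L.evol s ρ)) = 0 := by
  have h1 := (expectCLM v).hasFDerivAt.comp_hasDerivAt s (L.hasDerivAt_evol ρ s)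
  refine IsLocalMin.hasDerivAt_eq_zero ?_ h1
  filter_upwards [lt_mem_nhds hs] with u hu
  simp only [Function.comp_apply, expectCLM_apply]
  have h2 : expect v (L.evol s ρ) = 0 := by simp [expect, hv]
  rw [h2]
  exact expect_nonneg v (hρ.evol L hu.le).nonneg

/-- The spectra along the trajectory stay in one compact ball, where `-x log x` is continuous, so
the functional calculus is continuous in the operator. -/
theorem continuousOn_vnEntropy_evol (hρ : IsState ρ) (t : ℝ) :
    ContinuousOn (fun s => vnEntropy (L.evol s ρ)) (Set.Icc 0 t) := by
  have := hρ.nontrivial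
  have hc := (L.continuous_evol ρ).continuousOn (s := Set.Icc 0 t)
  obtain ⟨M, hM⟩ := isCompact_Icc.exists_bound_of_continuousOn hc
  have h1 : ContinuousOn (fun s => cfc Real.negMulLog (L.evol s ρ)) (Set.Icc 0 t) := by
    refine ContinuousOn.cfc' (isCompact_closedBall (0 : ℝ) M) _ hc (fun s hs x hx => ?_)
      (fun s hs => (hρ.evol L hs.1).isSelfAdjoint) Real.continuous_negMulLog.continuousOn
    rw [mem_closedBall_zero_iff]
    exact (spectrum.norm_le_norm_of_mem hx).trans (hM s hs)
  set b := stdOrthonormalBasis ℂ ℋ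
  have h2 : ContinuousOn (fun s => ∑ i, expect (b i) (cfc Real.negMulLog (L.evol s ρ)))
      (Set.Icc 0 t) :=
    continuousOn_finsetSum _ fun i _ => (expectCLM (b i)).continuous.comp_continuousOn h1
  exact h2.congr fun s hs => vnEntropy_eq_sum b (hρ.evol L hs.1).isSelfAdjoint

/-- Faithfulness rules out the infinite branch of the relative entropy. The quotient splits into the
entropy slope, possibly divergent, minus the smooth flux slope. -/
theorem epQuotient_eq {ρplus : ℋ →L[ℂ] ℋ} (hf : IsFaithful ρplus) (ρ : ℋ →L[ℂ] ℋ) (h : ℝ) :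
    epQuotient L ρplus ρ h = (((vnEntropy (L.evol h ρ) - vnEntropy ρ) / h -
      ((bracket (L.evol h ρ) (-CFC.log ρplus)).re - (bracket ρ (-CFC.log ρplus)).re) / h : ℝ) :
        EReal) := by
  have h1 : ∀ μ, relEntropy μ ρplus =
      ((-vnEntropy μ + (bracket μ (-CFC.log ρplus)).re : ℝ) : EReal) := fun μ => by
    rw [relEntropy, if_pos fun v hv => by rw [hf v hv, map_zero]]
    congr 1
    simp only [vnEntropy, ← bracketCLM_apply, map_sub, map_neg, Complex.sub_re, Complex.neg_re]
    ring
  rw [epQuotient, h1, h1, ← EReal.coe_sub, ← EReal.coe_div]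
  congr 1
  ring

theorem hasDerivAt_bracket_evol (ρ S : ℋ →L[ℂ] ℋ) (s : ℝ) :
    HasDerivAt (fun u => bracket (L.evol u ρ) S) (bracket (L.evol s ρ) (L.dualGen S)) s := by
  have h1 := ((L.hasDerivAt_evol ρ s).star).mul_const S
  have h2 := (trCLM.restrictScalars ℝ).hasFDerivAt.comp_hasDerivAt s h1
  rw [← L.bracket_gen]
  exact h2

theorem tendsto_slope_bracket_evol (ρ S : ℋ →L[ℂ] ℋ) :
    Tendsto (fun h => ((bracket (L.evol h ρ) S).re - (bracket ρ S).re) / h) (𝓝[>] 0)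
      (𝓝 (bracket ρ (L.dualGen S)).re) := by
  have h1 := Complex.reCLM.hasFDerivAt.comp_hasDerivAt 0 (hasDerivAt_bracket_evol L ρ S 0)
  have h2 := (hasDerivAt_iff_tendsto_slope.1 h1).mono_left
    (nhdsWithin_mono 0 fun x (hx : 0 < x) => hx.ne')
  rw [L.evol_zero] at h2
  refine h2.congr fun h => ?_
  simp [slope_def_field, L.evol_zero]

theorem tendsto_epQuotient_of_tendsto {ρplus : ℋ →L[ℂ] ℋ} (hf : IsFaithful ρplus) {d : ℝ}
    (h : Tendsto (fun h => (vnEntropy (L.evol h ρ) - vnEntropy ρ) / h) (𝓝[>] 0) (𝓝 d)) :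
    Tendsto (epQuotient L ρplus ρ) (𝓝[>] 0)
      (𝓝 ((d - (bracket ρ (L.dualGen (-CFC.log ρplus))).re : ℝ) : EReal)) := by
  rw [funext (epQuotient_eq L hf ρ)]
  exact (continuous_coe_real_ereal.tendsto _).comp (h.sub (tendsto_slope_bracket_evol L ρ _))

theorem tendsto_epQuotient_of_atTop {ρplus : ℋ →L[ℂ] ℋ} (hf : IsFaithful ρplus)
    (h : Tendsto (fun h => (vnEntropy (L.evol h ρ) - vnEntropy ρ) / h) (𝓝[>] 0) atTop) :
    Tendsto (epQuotient L ρplus ρ) (𝓝[>] 0) (𝓝 ⊤) := by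
  rw [funext (epQuotient_eq L hf ρ)]
  refine EReal.tendsto_coe_nhds_top_iff.2 ?_
  simp only [sub_eq_add_neg _ (_ / _ : ℝ)]
  exact h.atTop_add (tendsto_slope_bracket_evol L ρ _).neg

theorem tendsto_epQuotient {ρplus : ℋ →L[ℂ] ℋ} (hf : IsFaithful ρplus) (hρ : IsState ρ) :
    Tendsto (epQuotient L ρplus ρ) (𝓝[>] 0) (𝓝 (entropyProduction L ρplus ρ)) := by
  refine tendsto_nhds_limUnder ?_
  rcases entropy_slope L hρ with ⟨d, -, hd⟩ | ⟨-, h⟩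
  · exact ⟨_, tendsto_epQuotient_of_tendsto L hf hd⟩
  · exact ⟨_, tendsto_epQuotient_of_atTop L hf h⟩

/-- At positive times the entropy has a right derivative, the entropy production is finite, and
they differ by the entropy flux. -/
theorem entropyProduction_evol {ρplus : ℋ →L[ℂ] ℋ} (hf : IsFaithful ρplus) (hρ : IsState ρ)
    {s : ℝ} (hs : 0 < s) : ∃ d, -(Module.finrank ℂ ℋ * ‖L.Phi 1‖) ≤ d ∧
      HasDerivWithinAt (fun u => vnEntropy (L.evol u ρ)) d (Set.Ioi s) s ∧
      entropyProduction L ρplus (L.evol s ρ) =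
        ((d - (bracket (L.evol s ρ) (L.dualGen (-CFC.log ρplus))).re : ℝ) : EReal) := by
  have hρs := hρ.evol L hs.le
  rcases entropy_slope L hρs with ⟨d, hd, h⟩ | ⟨⟨v, hv, hv'⟩, -⟩
  · refine ⟨d, hd, ?_, (tendsto_epQuotient_of_tendsto L hf h).limUnder_eq⟩
    rw [hasDerivWithinAt_iff_tendsto_slope' (by simp)]
    have h1 : Tendsto (fun u => u - s) (𝓝[>] s) (𝓝[>] 0) := by
      refine tendsto_nhdsWithin_iff.2 ⟨?_, ?_⟩
      · have : Continuous fun u : ℝ => u - s := by fun_prop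
        simpa using (this.tendsto s).mono_left nhdsWithin_le_nhds
      · filter_upwards [self_mem_nhdsWithin] with u hu
        exact Set.mem_Ioi.2 (sub_pos.2 (Set.mem_Ioi.1 hu))
    refine (h.comp h1).congr fun u => ?_
    simp [slope_def_field, L.evol_add]
  · exact absurd (expect_gen_evol_of_ker L hρ hs hv) hv'

/-- A continuous function with right derivatives bounded below has an integrable right derivative. A
possible value `⊤` at time `0`, which `toReal` sends to `0`, affects only a null set. -/
theorem entropy_balance {ρplus : ℋ →L[ℂ] ℋ} (hf : IsFaithful ρplus) (hρ : IsState ρ)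
    {t : ℝ} (ht : 0 ≤ t) :
    IntervalIntegrable (fun s => (entropyProduction L ρplus (L.evol s ρ)).toReal) volume 0 t ∧
      ∫ s in (0 : ℝ)..t, (entropyProduction L ρplus (L.evol s ρ)).toReal =
        vnEntropy (L.evol t ρ) - vnEntropy ρ -
          ∫ s in (0 : ℝ)..t, (bracket (L.evol s ρ) (L.dualGen (-CFC.log ρplus))).re := by
  set C : ℝ := Module.finrank ℂ ℋ * ‖L.Phi 1‖
  set j : ℝ → ℝ := fun s => (bracket (L.evol s ρ) (L.dualGen (-CFC.log ρplus))).re with hj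
  have hjc : Continuous j := Complex.continuous_re.comp <|
    continuous_iff_continuousAt.2 fun s => (hasDerivAt_bracket_evol L ρ _ s).continuousAt
  set ep : ℝ → ℝ := fun s => (entropyProduction L ρplus (L.evol s ρ)).toReal with hep
  have hd : ∀ s, 0 < s → -C ≤ ep s + j s ∧
      HasDerivWithinAt (fun u => vnEntropy (L.evol u ρ)) (ep s + j s) (Set.Ioi s) s := by
    intro s hs
    obtain ⟨d, h1, h2, h3⟩ := entropyProduction_evol L hf hρ hs
    have h4 : ep s + j s = d := by simp only [hep, h3, EReal.toReal_coe, hj]; ring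
    rw [h4]
    exact ⟨h1, h2⟩
  have hcont := continuousOn_vnEntropy_evol L hρ t
  have hint : IntervalIntegrable (fun s => ep s + j s) volume 0 t := by
    -- Adding `C s` to the entropy makes its right derivative nonnegative.
    have h1 : IntegrableOn (fun s => ep s + j s + C) (Set.Ioc 0 t) :=
      intervalIntegral.integrableOn_deriv_right_of_nonneg
        (g := fun s => vnEntropy (L.evol s ρ) + C * s) (hcont.add (by fun_prop))
        (fun s hs => by
          exact ((hd s hs.1).2.add ((hasDerivWithinAt_id s _).const_mul C)).congr_deriv (by simp))
        (fun s hs => by linarith [(hd s hs.1).1])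
    have h2 := (intervalIntegrable_iff_integrableOn_Ioc_of_le ht).2 h1
    simpa using h2.sub (intervalIntegrable_const (c := C))
  have hji : IntervalIntegrable j volume 0 t := hjc.intervalIntegrable _ _
  have hepi : IntervalIntegrable ep volume 0 t := by simpa using hint.sub hji
  refine ⟨hepi, ?_⟩
  have h3 := intervalIntegral.integral_eq_sub_of_hasDeriv_right_of_le ht hcont
    (fun s hs => (hd s hs.1).2) hint
  rw [intervalIntegral.integral_add hepi hji, L.evol_zero] at h3
  linarith

end EntropyAlongTrajectory

end OpenQS

/-! ### The measurement statistics combined with the entropy balance. -/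

theorem mainTheorem2 {ℋ : Type*} [NormedAddCommGroup ℋ] [InnerProductSpace ℂ ℋ]
    [CompleteSpace ℋ] [FiniteDimensional ℂ ℋ] {κ : Type*} [Fintype κ]
    (L : OpenQS.Lindbladian ℋ κ) (ρplus : ℋ →L[ℂ] ℋ) (hDB : L.DetailedBalance ρplus)
    (Splus : ℋ →L[ℂ] ℋ) (hSplus : Splus = -CFC.log ρplus)
    (ρ₀ : ℋ →L[ℂ] ℋ) (hρ₀ : OpenQS.IsState ρ₀) (t : ℝ) (ht : 0 ≤ t) :
    -- the two-time measurement law is a probability law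
    IsProbabilityMeasure (OpenQS.twoTimeLaw L Splus ρ₀ t) ∧
    -- no decoherence: the law of the second outcome is not affected by the first measurement
    (∀ s' ∈ OpenQS.spec Splus,
      ∑ s ∈ OpenQS.spec Splus,
          OpenQS.bracket
            (L.evol t (OpenQS.specProj Splus s * ρ₀ * OpenQS.specProj Splus s))
            (OpenQS.specProj Splus s') =
        OpenQS.bracket (L.evol t ρ₀) (OpenQS.specProj Splus s')) ∧
    -- the expected variation is a difference of expectation values
    (OpenQS.twoTimeExpectation L Splus ρ₀ t : ℂ) =
      OpenQS.bracket (L.evol t ρ₀) Splus - OpenQS.bracket ρ₀ Splus ∧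
    -- the expected variation is the integrated entropy flux
    (OpenQS.twoTimeExpectation L Splus ρ₀ t : ℂ) =
      ∫ s in (0 : ℝ)..t, OpenQS.bracket (L.evol s ρ₀) (L.dualGen Splus) ∧
    -- the entropy production along the trajectory exists as a limit, is finite at positive
    -- times and is integrable
    (∀ s : ℝ, 0 ≤ s →
      Tendsto (OpenQS.epQuotient L ρplus (L.evol s ρ₀)) (𝓝[>] 0)
        (𝓝 (OpenQS.entropyProduction L ρplus (L.evol s ρ₀)))) ∧
    (∀ s : ℝ, 0 < s →
      OpenQS.entropyProduction L ρplus (L.evol s ρ₀) ≠ ⊤ ∧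
      OpenQS.entropyProduction L ρplus (L.evol s ρ₀) ≠ ⊥) ∧
    IntervalIntegrable
      (fun s => (OpenQS.entropyProduction L ρplus (L.evol s ρ₀)).toReal) volume 0 t ∧
    -- the entropy balance
    OpenQS.twoTimeExpectation L Splus ρ₀ t =
      OpenQS.vnEntropy (L.evol t ρ₀) - OpenQS.vnEntropy ρ₀ -
        ∫ s in (0 : ℝ)..t,
          (OpenQS.entropyProduction L ρplus (L.evol s ρ₀)).toReal := by
  have hf := hDB.faithful
  have hρplus := hDB.state.isSelfAdjoint
  have hS : IsSelfAdjoint Splus := by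
    rw [hSplus]
    exact (cfc_predicate (R := ℝ) (p := IsSelfAdjoint) Real.log ρplus).neg
  have hc : ∀ X, Commute ρplus X → Commute Splus X := fun X hX => by
    rw [hSplus]
    exact (hX.cfc_real Real.log).neg_left
  have hρS : Commute ρplus Splus := (hc ρplus (Commute.refl _)).symm
  have hE := OpenQS.twoTimeExpectation_eq L hDB hS hc hρS hρ₀ ht
  have hcont : Continuous fun s => OpenQS.bracket (L.evol s ρ₀) (L.dualGen Splus) :=
    continuous_iff_continuousAt.2 fun s =>
      (OpenQS.hasDerivAt_bracket_evol L ρ₀ (L.dualGen Splus) s).continuousAt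
  have hflux : ∫ s in (0 : ℝ)..t, OpenQS.bracket (L.evol s ρ₀) (L.dualGen Splus) =
      OpenQS.bracket (L.evol t ρ₀) Splus - OpenQS.bracket ρ₀ Splus := by
    rw [intervalIntegral.integral_eq_sub_of_hasDerivAt
      (fun s _ => OpenQS.hasDerivAt_bracket_evol L ρ₀ Splus s) (hcont.intervalIntegrable _ _),
      L.evol_zero]
  have hbal := OpenQS.entropy_balance L hf hρ₀ ht
  rw [← hSplus] at hbal
  refine ⟨OpenQS.isProbabilityMeasure_twoTimeLaw L hS hρ₀ ht, fun s' _ => ?_, hE,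
    hE.trans hflux.symm, fun s hs => OpenQS.tendsto_epQuotient L hf (hρ₀.evol L hs),
    fun s hs => ?_, hbal.1, ?_⟩
  · exact hDB.sum_bracket_evol hS hc ρ₀ (OpenQS.commute_specProj hS hρS.symm s').symm t
  · obtain ⟨d, -, -, h⟩ := OpenQS.entropyProduction_evol L hf hρ₀ hs
    rw [h]
    exact ⟨EReal.coe_ne_top _, EReal.coe_ne_bot _⟩
  · have h1 : OpenQS.twoTimeExpectation L Splus ρ₀ t =
        ∫ s in (0 : ℝ)..t, (OpenQS.bracket (L.evol s ρ₀) (L.dualGen Splus)).re := by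
      have h2 := Complex.reCLM.intervalIntegral_comp_comm
        (hcont.intervalIntegrable (μ := MeasureTheory.volume) 0 t)
      simp only [Complex.reCLM_apply] at h2
      rw [h2, hflux, ← hE, Complex.ofReal_re]
    rw [h1, hbal.2]
    ring
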